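/- Let $(R,\mathfrak m)$ be a Noetherian local ring, and let $M$ be a generalized Cohen–Macaulay $R$-module of dimension $d>0$, that is, a finitely generated $R$-module of Krull dimension $d>0$ such that some positive power of $\mathfrak m$ annihilates the local cohomology modules $H^i_{\mathfrak m}(M)$ for all $i<d$. Let $n_0$ be a positive integer such that $\mathfrak m^{n_0}H^i_{\mathfrak m}(M)=0$ for all $i<d$. A parameter ideal of $M$ is an ideal $\mathfrak q=(x_1,\dots,x_d)$ generated by $d$ elements of $\mathfrak m$ such that $M/\mathfrak qM$ has finite length. For a submodule $N$ of $M$ and an ideal $J$ of $R$ write $N:_MJ=\{x\in M : Jx\subseteq N\}$; for an $R$-module $H$ write $0:_HJ=\{x\in H: Jx=0\}$ and $\operatorname{Soc}(H)=0:_H\mathfrak m$. Then for every integer $0\le k\le n_0$ and every parameter ideal $\mathfrak q$ of $M$ contained in $\mathfrak m^{2n_0}$, the length $\ell_R\big((\mathfrak qM:_M\mathfrak m^k)/\mathfrak qM\big)$ is independent of the choice of $\mathfrak q$ and is given by $$\ell_R\big((\mathfrak qM:_M\mathfrak m^k)/\mathfrak qM\big)=\sum_{i=0}^{d}\binom di\,\ell_R\big(0:_{H^i_{\mathfrak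 m}(M)}\mathfrak m^k\big).$$ In particular, the index of irreducibility $N_R(\mathfrak q,M)=\dim_{R/\mathfrak m}\operatorname{Soc}(M/\mathfrak qM)$ is the same for all parameter ideals $\mathfrak q$ of $M$ contained in $\mathfrak m^{2n_0}$, and $$N_R(\mathfrak q,M)=\sum_{i=0}^{d}\binom di\dim_{R/\mathfrak m}\operatorname{Soc}\big(H^i_{\mathfrak m}(M)\big).$$ -/

import Mathlib

open IsLocalRing

universe u

noncomputable section

namespace GenCM

/-- The submodule `N :_M J = {x ∈ M | J x ⊆ N}` of `M`. -/
def colonIn {R : Type*} [CommRing R] {M : Type*} [AddCommGroup M] [Module R M]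
    (N : Submodule R M) (J : Ideal R) : Submodule R M where
  carrier := {x | ∀ a ∈ J, a • x ∈ N}
  zero_mem' := fun a _ => by simp
  add_mem' := fun {x y} hx hy a ha => by
    rw [smul_add]
    exact N.add_mem (hx a ha) (hy a ha)
  smul_mem' := fun r x hx a ha => by
    rw [smul_comm]
    exact N.smul_mem r (hx a ha)

/-- The quotient module `(N :_M J) / N` (note that `N ⊆ N :_M J`). -/
abbrev ColonQuotient {R : Type*} [CommRing R] {M : Type*} [AddCommGroup M] [Module R M]
    (N : Submodule R M) (J : Ideal R) : Type _ :=
  ↥(colonIn N J) ⧸ N.submoduleOf (colonIn N J)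

/-- The submodule `0 :_N J` of all elements of `N` that are annihilated by the ideal `J`. -/
abbrev zeroColon {R : Type*} [CommRing R] (N : Type*) [AddCommGroup N] [Module R N]
    (J : Ideal R) : Submodule R N :=
  Submodule.torsionBySet R N (J : Set R)

section LocalRing

variable (R : Type u) [CommRing R] [IsLocalRing R]

/-- The socle of a module over a local ring `(R, 𝔪)`: `Soc N = 0 :_N 𝔪`. -/
abbrev Soc (N : Type*) [AddCommGroup N] [Module R N] : Submodule R N :=
  zeroColon N (maximalIdeal R)

/-- The dimension of `Soc N` as a vector space over `R / 𝔪`. -/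
def socDim (N : Type u) [AddCommGroup N] [Module R N] : Cardinal.{u} :=
  Module.rank (R ⧸ maximalIdeal R) (Soc R N)

variable (M : Type u) [AddCommGroup M] [Module R M]

/-- The `i`-th local cohomology module of `M` with support in the maximal ideal. -/
abbrev H (i : ℕ) : Type u :=
  (localCohomology (maximalIdeal R) i).obj (ModuleCat.of R M)

/-- `M` is a generalized Cohen-Macaulay module of dimension `d`: it is finitely generated, of
dimension `d > 0`, and some positive power of `𝔪` annihilates `H^i_𝔪(M)` for all `i < d`. -/
structure IsGeneralizedCohenMacaulay (d : ℕ) : Prop where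
  finite : Module.Finite R M
  dim_eq : Module.supportDim R M = d
  dim_pos : 0 < d
  exists_pow : ∃ k : ℕ, 0 < k ∧
    ∀ i < d, maximalIdeal R ^ k • (⊤ : Submodule R (H R M i)) = ⊥

/-- `q` is a parameter ideal of `M`: it is generated by a system of parameters of `M`, that is, by
`dim M` elements `x₁, …, x_d` of `𝔪` such that `M / (x₁, …, x_d) M` has finite length. -/
def IsParameterIdeal (q : Ideal R) : Prop :=
  ∃ d : ℕ, Module.supportDim R M = d ∧ ∃ x : Fin d → R,
    (∀ j, x j ∈ maximalIdeal R) ∧ q = Ideal.span (Set.range x) ∧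
      IsFiniteLength R (M ⧸ q • (⊤ : Submodule R M))

/-- The index of irreducibility `N_R(q, M) = dim_{R/𝔪} Soc (M / qM)`. -/
def indexOfIrreducibility (q : Ideal R) : Cardinal.{u} :=
  socDim R (M ⧸ q • (⊤ : Submodule R M))

end LocalRing

end GenCM

end

/-! The proof is an induction on the number of parameters. Let x be the first one, T = 0 :_M x and
M' = M / xM. Parameters turn out to be filter regular, so T is 𝔪-power torsion; hence M and M / T
have the same local cohomology in positive degrees. Multiplication by x gives 0 → M / T → M → M' →
0. Since x kills Hⁱ(M) for i < d, the map Hⁱ(M / T) → Hⁱ(M) vanishes, so Hⁱ(M) embeds in Hⁱ(M') with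
cokernel inside Hⁱ⁺¹(M).

The crux is that 0 :_{Hⁱ(M')} 𝔪^k → 0 :_{Hⁱ⁺¹(M)} 𝔪^k is onto for k ≤ n₀ and i < d
(`exists_lift_annihilated`). As x ∈ 𝔪^{2n₀}, write x = ∑ yⱼ zⱼ with yⱼ, zⱼ ∈ 𝔪^{n₀} and factor
multiplication by x as M / T → (M / T)^s → M through the zⱼ and then the yⱼ. The zⱼ kill the given
class, so it lifts to the cokernel of the first map; the yⱼ kill Hⁱ(M), so the image of this lift in
Hⁱ(M') is again annihilated by 𝔪^k.

Thus the 𝔪^k-annihilated parts form short exact sequences (`exists_zeroColon_exact`). The case k =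
n₀ also shows that 𝔪^{n₀} kills Hⁱ(M') for i < d - 1 (`smul_lc_quotient_eq_zero`), so the exponent
survives the induction. Pascal's rule assembles the binomial sum, and once all parameters are used
the module is torsion and equals its own H⁰ (`invariant_quotient_eq_sum`).

Filter regularity comes from `le_coheight_of_smul_lc_eq_zero`: annihilation below degree d forces
dim R / p ≥ d for every associated prime p ≠ 𝔪. The long exact sequence is obtained from explicit
cocycles on projective resolutions of the R / J^t. -/

noncomputable section

/-! ### Ext groups through cocycles on a projective resolution. -/

namespace ExtCocycle

open CategoryTheory Limits Opposite

variable {R : Type u} [CommRing R] {X : ModuleCat.{u} R} (P : ProjectiveResolution X)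
  (Y : ModuleCat.{u} R) (n : ℕ)

/-- The functor `Hom(-, Y)` with values in the opposite category. -/
abbrev homFunctor : ModuleCat.{u} R ⥤ (ModuleCat.{u} R)ᵒᵖ :=
  ((linearYoneda R (ModuleCat.{u} R)).obj Y).rightOp

/-- The complex `Hom(P, Y)` as a chain complex in the opposite category. -/
abbrev homComplex : ChainComplex (ModuleCat.{u} R)ᵒᵖ ℕ :=
  ((homFunctor Y).mapHomologicalComplex _).obj P.complex

variable {Y n}

/-- A cochain as a morphism from `Hom(P, Y)` to the base ring in the opposite category. -/
def cochainHom (f : P.complex.X n ⟶ Y) : (homComplex P Y).X n ⟶ op (ModuleCat.of R R) :=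
  (ModuleCat.ofHom (LinearMap.toSpanSingleton R (P.complex.X n ⟶ Y) f)).op

lemma d_cochainHom {m : ℕ} (f : P.complex.X n ⟶ Y) :
    (homComplex P Y).d m n ≫ cochainHom P f = cochainHom P (P.complex.d m n ≫ f) := by
  apply Quiver.Hom.unop_inj
  ext
  simp [cochainHom, homComplex]
  rfl

lemma cochainHom_zero : cochainHom P (0 : P.complex.X n ⟶ Y) = 0 := by
  apply Quiver.Hom.unop_inj
  ext
  simp [cochainHom]
  rfl

lemma exists_cochainHom_eq (k : (homComplex P Y).X n ⟶ op (ModuleCat.of R R)) :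
    ∃ f, k = cochainHom P f := by
  refine ⟨k.unop.hom (1 : R), ?_⟩
  apply Quiver.Hom.unop_inj
  ext
  simp [cochainHom]
  exact (one_smul R _).symm

lemma cochainHom_injective {f g : P.complex.X n ⟶ Y} (h : cochainHom P f = cochainHom P g) :
    f = g := by
  have : (1 : R) • f = (1 : R) • g := congrArg (fun k => k.unop.hom (1 : R)) h
  simpa using this

/-- Ext is a left derived functor with values in the opposite category, so its elements are handled
as morphisms to `op R`; such a morphism is a linear map out of `R`, determined by its value at 1. -/
lemma hom_op_ext {Z : (ModuleCat.{u} R)ᵒᵖ} {k l : Z ⟶ op (ModuleCat.of R R)}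
    (h : k.unop.hom (1 : R) = l.unop.hom (1 : R)) : k = l := by
  apply Quiver.Hom.unop_inj
  ext
  exact h

lemma cochainHom_apply_one (f : P.complex.X n ⟶ Y) :
    (cochainHom P f).unop.hom (1 : R) = f :=
  one_smul R f

lemma cochainHom_add (f g : P.complex.X n ⟶ Y) :
    cochainHom P (f + g) = cochainHom P f + cochainHom P g := by
  apply hom_op_ext
  rw [cochainHom_apply_one]
  exact (congrArg₂ (· + ·) (cochainHom_apply_one P f) (cochainHom_apply_one P g)).symm

lemma cochainHom_smul (r : R) (f : P.complex.X n ⟶ Y) :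
    cochainHom P (r • f) = cochainHom P f ≫
      (ModuleCat.ofHom (LinearMap.toSpanSingleton R R r)).op := by
  apply hom_op_ext
  rw [cochainHom_apply_one]
  change r • f = ((1 : R) • r) • f
  simp

lemma map_cochainHom (f : P.complex.X n ⟶ Y) {Y' : ModuleCat.{u} R} (φ : Y ⟶ Y') :
    ((NatTrans.mapHomologicalComplex
      (NatTrans.rightOp ((linearYoneda R (ModuleCat.{u} R)).map φ) :
        homFunctor Y' ⟶ homFunctor Y) (ComplexShape.down ℕ)).app P.complex).f n ≫
      cochainHom P f = cochainHom P (f ≫ φ) := by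
  apply hom_op_ext
  rw [cochainHom_apply_one]
  exact congrArg (· ≫ φ) (cochainHom_apply_one P f)

lemma map_cochainHom_left (f : P.complex.X n ⟶ Y) {X' : ModuleCat.{u} R}
    (P' : ProjectiveResolution X') (l : P'.complex ⟶ P.complex) :
    (((homFunctor Y).mapHomologicalComplex (ComplexShape.down ℕ)).map l).f n ≫
      cochainHom P f = cochainHom P' (l.f n ≫ f) := by
  apply hom_op_ext
  rw [cochainHom_apply_one]
  exact congrArg (l.f n ≫ ·) (cochainHom_apply_one P f)

/-- The class of a cocycle as a morphism out of the homology. -/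
def homologyHom (f : P.complex.X n ⟶ Y) (hf : P.complex.d (n + 1) n ≫ f = 0) :
    (homComplex P Y).homology n ⟶ op (ModuleCat.of R R) :=
  (homComplex P Y).homologyι n ≫ (homComplex P Y).descOpcycles (cochainHom P f) (n + 1) (by simp)
    (by rw [d_cochainHom, hf, cochainHom_zero])

lemma exists_homologyHom_eq (k : (homComplex P Y).homology n ⟶ op (ModuleCat.of R R)) :
    ∃ f hf, k = homologyHom P (Y := Y) f hf := by
  -- `R` is projective, so `op R` is injective in the opposite category and `k` extends from
  -- homology to opcycles, where it is given by a cochain.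
  let l := Injective.factorThru k ((homComplex P Y).homologyι n)
  obtain ⟨f, hf⟩ := exists_cochainHom_eq P ((homComplex P Y).pOpcycles n ≫ l)
  have h0 : P.complex.d (n + 1) n ≫ f = 0 := by
    apply cochainHom_injective P
    rw [← d_cochainHom, ← hf, cochainHom_zero, HomologicalComplex.d_pOpcycles_assoc, zero_comp]
  refine ⟨f, h0, ?_⟩
  have : l = (homComplex P Y).descOpcycles (cochainHom P f) (n + 1) (by simp)
      (by rw [d_cochainHom, h0, cochainHom_zero]) := by
    rw [← cancel_epi ((homComplex P Y).pOpcycles n), HomologicalComplex.p_descOpcycles, hf]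
  rw [homologyHom, ← this]
  exact (Injective.comp_factorThru _ _).symm

/-- Injectivity of `op R` extends a functional vanishing on homology along the next differential.
The index `j` stays existential so that degree 0 is covered: no differential leaves it, and the
coboundary is then zero. -/
lemma homologyHom_eq_zero_iff (f : P.complex.X n ⟶ Y) (hf : P.complex.d (n + 1) n ≫ f = 0) :
    homologyHom P f hf = 0 ↔ ∃ j g, f = P.complex.d n j ≫ g := by
  constructor
  · intro h
    let K := homComplex P Y
    let j := (ComplexShape.down ℕ).next n
    let S := ShortComplex.mk (K.homologyι n) (K.fromOpcycles n j)
      (HomologicalComplex.homologyι_comp_fromOpcycles _ _ _)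
    have hS : S.Exact := S.exact_of_f_is_kernel (K.homologyIsKernel n j rfl)
    let l := hS.descToInjective _ h
    obtain ⟨g, hg⟩ := exists_cochainHom_eq P l
    refine ⟨j, g, ?_⟩
    apply cochainHom_injective P
    rw [← d_cochainHom, ← hg]
    have := hS.comp_descToInjective _ h
    rw [← HomologicalComplex.p_fromOpcycles, Category.assoc]
    erw [this]
    rw [HomologicalComplex.p_descOpcycles]
  · rintro ⟨j, g, rfl⟩
    exact HomologicalComplex.homologyι_descOpcycles_eq_zero_of_boundary _ _ _ _
      (cochainHom P g) (by rw [d_cochainHom])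

variable (Y n) in
/-- The left derived functor of `Hom(-, Y)` in terms of a projective resolution. -/
def derivedIso : ((homFunctor Y).leftDerived n).obj X ≅ (homComplex P Y).homology n :=
  P.isoLeftDerivedObj (homFunctor Y) n

/-- The class in `Ext` of a cocycle. -/
def extClass (f : P.complex.X n ⟶ Y) (hf : P.complex.d (n + 1) n ≫ f = 0) :
    ((Ext R (ModuleCat.{u} R) n).obj (op X)).obj Y :=
  ((derivedIso P Y n).hom ≫ homologyHom P f hf).unop.hom (1 : R)

lemma exists_extClass_eq (e : ((Ext R (ModuleCat.{u} R) n).obj (op X)).obj Y) :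
    ∃ f hf, e = extClass P f hf := by
  let k : ((homFunctor Y).leftDerived n).obj X ⟶ op (ModuleCat.of R R) :=
    (ModuleCat.ofHom (LinearMap.toSpanSingleton R
      (((Ext R (ModuleCat.{u} R) n).obj (op X)).obj Y) e)).op
  obtain ⟨f, hf, h⟩ := exists_homologyHom_eq P ((derivedIso P Y n).inv ≫ k)
  refine ⟨f, hf, ?_⟩
  rw [extClass, ← h, Iso.hom_inv_id_assoc]
  exact (one_smul R e).symm

lemma extClass_eq_zero_iff (f : P.complex.X n ⟶ Y) (hf : P.complex.d (n + 1) n ≫ f = 0) :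
    extClass P f hf = 0 ↔ ∃ j g, f = P.complex.d n j ≫ g := by
  rw [← homologyHom_eq_zero_iff P f hf]
  constructor
  · intro h
    have : (derivedIso P Y n).hom ≫ homologyHom P f hf = 0 :=
      hom_op_ext (h.trans rfl)
    rwa [← cancel_epi (derivedIso P Y n).hom, comp_zero]
  · intro h
    rw [extClass, h, comp_zero]
    rfl

lemma map_extClass (f : P.complex.X n ⟶ Y) (hf : P.complex.d (n + 1) n ≫ f = 0)
    {Y' : ModuleCat.{u} R} (φ : Y ⟶ Y') :
    (((Ext R (ModuleCat.{u} R) n).obj (op X)).map φ).hom (extClass P f hf) =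
      extClass P (f ≫ φ) (by rw [reassoc_of% hf, zero_comp]) := by
  let α : homFunctor Y' ⟶ homFunctor Y :=
    NatTrans.rightOp ((linearYoneda R (ModuleCat.{u} R)).map φ)
  let β : homComplex P Y' ⟶ homComplex P Y :=
    (NatTrans.mapHomologicalComplex α (ComplexShape.down ℕ)).app P.complex
  have h1 : (NatTrans.leftDerived α n).app X ≫ (derivedIso P Y n).hom =
      (derivedIso P Y' n).hom ≫ HomologicalComplex.homologyMap β n := by
    have h0 : (NatTrans.leftDerived α n).app X = (derivedIso P Y' n).hom ≫
        HomologicalComplex.homologyMap β n ≫ (derivedIso P Y n).inv :=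
      ProjectiveResolution.leftDerived_app_eq α P n
    rw [h0, Category.assoc, Category.assoc, Iso.inv_hom_id, Category.comp_id]
  have h2 : HomologicalComplex.homologyMap β n ≫ homologyHom P f hf =
      homologyHom P (f ≫ φ) (by rw [reassoc_of% hf, zero_comp]) := by
    rw [homologyHom, homologyHom, HomologicalComplex.homologyι_naturality_assoc]
    congr 1
    rw [← cancel_epi ((homComplex P Y').pOpcycles n)]
    rw [HomologicalComplex.p_opcyclesMap_assoc, HomologicalComplex.p_descOpcycles,
      HomologicalComplex.p_descOpcycles]
    exact map_cochainHom P f φ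
  have h3 : (NatTrans.leftDerived α n).app X ≫ (derivedIso P Y n).hom ≫ homologyHom P f hf =
      (derivedIso P Y' n).hom ≫ homologyHom P (f ≫ φ) (by rw [reassoc_of% hf, zero_comp]) := by
    rw [reassoc_of% h1, h2]
  exact congrArg (fun k => k.unop.hom (1 : R)) h3

lemma map_extClass_left (f : P.complex.X n ⟶ Y) (hf : P.complex.d (n + 1) n ≫ f = 0)
    {X' : ModuleCat.{u} R} (P' : ProjectiveResolution X') (φ : X' ⟶ X)
    (l : P'.complex ⟶ P.complex) (hl : l.f 0 ≫ P.π.f 0 = P'.π.f 0 ≫ φ) :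
    (((Ext R (ModuleCat.{u} R) n).map φ.op).app Y).hom (extClass P f hf) =
      extClass P' (l.f n ≫ f) (by rw [← HomologicalComplex.Hom.comm_assoc, hf, comp_zero]) := by
  let β : homComplex P' Y ⟶ homComplex P Y :=
    ((homFunctor Y).mapHomologicalComplex (ComplexShape.down ℕ)).map l
  have h1 : ((homFunctor Y).leftDerived n).map φ ≫ (derivedIso P Y n).hom =
      (derivedIso P' Y n).hom ≫ HomologicalComplex.homologyMap β n :=
    ProjectiveResolution.isoLeftDerivedObj_hom_naturality φ P' P l hl _ _
  have h2 : HomologicalComplex.homologyMap β n ≫ homologyHom P f hf =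
      homologyHom P' (l.f n ≫ f)
        (by rw [← HomologicalComplex.Hom.comm_assoc, hf, comp_zero]) := by
    rw [homologyHom, homologyHom, HomologicalComplex.homologyι_naturality_assoc]
    congr 1
    rw [← cancel_epi ((homComplex P' Y).pOpcycles n)]
    rw [HomologicalComplex.p_opcyclesMap_assoc, HomologicalComplex.p_descOpcycles,
      HomologicalComplex.p_descOpcycles]
    exact map_cochainHom_left P f P' l
  have h3 : ((homFunctor Y).leftDerived n).map φ ≫ (derivedIso P Y n).hom ≫ homologyHom P f hf =
      (derivedIso P' Y n).hom ≫ homologyHom P' (l.f n ≫ f)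
        (by rw [← HomologicalComplex.Hom.comm_assoc, hf, comp_zero]) := by
    rw [reassoc_of% h1, h2]
  exact congrArg (fun k => k.unop.hom (1 : R)) h3

lemma extClass_add (f g : P.complex.X n ⟶ Y) (hf : P.complex.d (n + 1) n ≫ f = 0)
    (hg : P.complex.d (n + 1) n ≫ g = 0) :
    extClass P (f + g) (by rw [Preadditive.comp_add, hf, hg, add_zero]) =
      extClass P f hf + extClass P g hg := by
  have : homologyHom P (f + g) (by rw [Preadditive.comp_add, hf, hg, add_zero]) =
      homologyHom P f hf + homologyHom P g hg := by
    rw [homologyHom, homologyHom, homologyHom]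
    refine Eq.trans ?_ (Preadditive.comp_add _ _ _ _ _ _)
    congr 1
    rw [← cancel_epi ((homComplex P Y).pOpcycles n)]
    refine Eq.trans ?_ (Preadditive.comp_add _ _ _ _ _ _).symm
    rw [HomologicalComplex.p_descOpcycles, HomologicalComplex.p_descOpcycles,
      HomologicalComplex.p_descOpcycles]
    exact cochainHom_add P f g
  rw [extClass, this, Preadditive.comp_add]
  rfl

lemma extClass_smul (r : R) (f : P.complex.X n ⟶ Y) (hf : P.complex.d (n + 1) n ≫ f = 0) :
    extClass P (r • f) (by rw [Linear.comp_smul, hf, smul_zero]) = r • extClass P f hf := by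
  let k : op (ModuleCat.of R R) ⟶ op (ModuleCat.of R R) :=
    (ModuleCat.ofHom (LinearMap.toSpanSingleton R R r)).op
  have : homologyHom P (r • f) (by rw [Linear.comp_smul, hf, smul_zero]) =
      homologyHom P f hf ≫ k := by
    rw [homologyHom, homologyHom, Category.assoc]
    congr 1
    rw [← cancel_epi ((homComplex P Y).pOpcycles n),
      HomologicalComplex.p_descOpcycles_assoc,
      HomologicalComplex.p_descOpcycles]
    exact cochainHom_smul P r f
  rw [extClass, this, ← Category.assoc]
  change ((derivedIso P Y n).hom ≫ homologyHom P f hf).unop.hom (k.unop.hom (1 : R)) = _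
  have h1 : k.unop.hom (1 : R) = r • (1 : R) := by
    change (1 : R) • r = r • (1 : R)
    simp
  rw [h1, map_smul]
  rfl

end ExtCocycle

/-! ### Local cohomology classes as cocycles on resolutions of the powers R / J^t. -/

namespace LocCoh

open CategoryTheory Limits Opposite

variable {R : Type u} [CommRing R] (J : Ideal R)

/-- A projective resolution of `R / J ^ t`. -/
def resolution (t : ℕ) : ProjectiveResolution (ModuleCat.of R (R ⧸ J ^ t)) :=
  projectiveResolution _

/-- The terms of a projective resolution of `R / J ^ t`. -/
abbrev Res (t i : ℕ) : Type u := (resolution J t).complex.X i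

instance (t i : ℕ) : Module.Projective R (Res J t i) :=
  (IsProjective.iff_projective _).2 ((resolution J t).projective i)

/-- The differential of the resolution of `R / J ^ t`. -/
def dRes (t i j : ℕ) : Res J t i →ₗ[R] Res J t j :=
  ((resolution J t).complex.d i j).hom

/-- The projection `R / J ^ t' → R / J ^ t` for `t ≤ t'`. -/
def projPow {t t' : ℕ} (h : t ≤ t') : (R ⧸ J ^ t') →ₗ[R] (R ⧸ J ^ t) :=
  Submodule.mapQ _ _ LinearMap.id (Ideal.pow_le_pow_right h)

/-- A lift of the projection `R / J ^ t' → R / J ^ t` to the resolutions. -/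
def transComplex {t t' : ℕ} (h : t ≤ t') :
    (resolution J t').complex ⟶ (resolution J t).complex :=
  ProjectiveResolution.lift (ModuleCat.ofHom (projPow J h)) _ _

/-- The terms of a lift of the projection `R / J ^ t' → R / J ^ t` to the resolutions. -/
def trans {t t' : ℕ} (h : t ≤ t') (i : ℕ) : Res J t' i →ₗ[R] Res J t i :=
  ((transComplex J h).f i).hom

/-- The augmentation of the resolution of `R / J ^ t`. -/
def aug (t : ℕ) : Res J t 0 →ₗ[R] R ⧸ J ^ t := ((resolution J t).π.f 0).hom

lemma dRes_comp_dRes (t i j k : ℕ) : dRes J t j k ∘ₗ dRes J t i j = 0 := by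
  have := (resolution J t).complex.d_comp_d i j k
  exact congrArg ModuleCat.Hom.hom this

lemma dRes_eq_zero (t : ℕ) {i j : ℕ} (h : j + 1 ≠ i) : dRes J t i j = 0 := by
  have := (resolution J t).complex.shape i j h
  exact congrArg ModuleCat.Hom.hom this

lemma trans_comp_dRes {t t' : ℕ} (h : t ≤ t') (i j : ℕ) :
    trans J h j ∘ₗ dRes J t' i j = dRes J t i j ∘ₗ trans J h i := by
  have := (transComplex J h).comm i j
  exact (congrArg ModuleCat.Hom.hom this).symm

lemma aug_comp_trans {t t' : ℕ} (h : t ≤ t') :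
    aug J t ∘ₗ trans J h 0 = projPow J h ∘ₗ aug J t' := by
  have := ProjectiveResolution.lift_commutes_zero (ModuleCat.ofHom (projPow J h))
    (resolution J t') (resolution J t)
  exact (congrArg ModuleCat.Hom.hom this)

lemma aug_surjective (t : ℕ) : Function.Surjective (aug J t) := by
  have : Epi ((resolution J t).π.f 0) := inferInstance
  exact (ModuleCat.epi_iff_surjective _).1 this

lemma exact_dRes_aug (t : ℕ) : Function.Exact (dRes J t 1 0) (aug J t) := by
  have := (resolution J t).exact₀
  exact (ShortComplex.ShortExact.moduleCat_exact_iff_function_exact _).1 this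

lemma dRes_exact (t i : ℕ) : Function.Exact (dRes J t (i + 2) (i + 1)) (dRes J t (i + 1) i) := by
  have := (resolution J t).exact_succ i
  exact (ShortComplex.ShortExact.moduleCat_exact_iff_function_exact _).1 this

/-- The `i`-th local cohomology module of `A` with support in `J`. -/
abbrev LC (i : ℕ) (A : Type u) [AddCommGroup A] [Module R A] : Type u :=
  (localCohomology J i).obj (ModuleCat.of R A)

/-- The map induced in local cohomology. -/
def map (i : ℕ) {A B : Type u} [AddCommGroup A] [Module R A] [AddCommGroup B] [Module R B]
    (f : A →ₗ[R] B) : LC J i A →ₗ[R] LC J i B :=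
  ((localCohomology J i).map (ModuleCat.ofHom f)).hom

variable {A B : Type u} [AddCommGroup A] [Module R A] [AddCommGroup B] [Module R B]

/-- The diagram defining local cohomology. -/
abbrev extDiagram (i : ℕ) : (ℕᵒᵖ)ᵒᵖ ⥤ ModuleCat.{u} R ⥤ ModuleCat.{u} R :=
  localCohomology.diagram (localCohomology.idealPowersDiagram J) i

/-- The structure maps of the colimit. -/
def incl (t i : ℕ) (A : Type u) [AddCommGroup A] [Module R A] :
    ((Ext R (ModuleCat.{u} R) i).obj (op (ModuleCat.of R (R ⧸ J ^ t)))).obj (ModuleCat.of R A) ⟶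
      (localCohomology J i).obj (ModuleCat.of R A) :=
  ((colimit.ι (extDiagram J i) (op (op t))).app (ModuleCat.of R A))

/-- The local cohomology module is a colimit of `Ext` modules. -/
def inclIsColimit (i : ℕ) (A : Type u) [AddCommGroup A] [Module R A] :
    IsColimit (((evaluation _ _).obj (ModuleCat.of R A)).mapCocone
      (colimit.cocone (extDiagram J i))) :=
  isColimitOfPreserves _ (colimit.isColimit _)

/-- The class in local cohomology of a cocycle with respect to the resolution of `R / J ^ t`. -/
def cl {i : ℕ} (t : ℕ) (f : Res J t i →ₗ[R] A) (hf : f ∘ₗ dRes J t (i + 1) i = 0) : LC J i A :=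
  (incl J t i A).hom (ExtCocycle.extClass (resolution J t) (Y := ModuleCat.of R A) (n := i)
    (ModuleCat.ofHom f) (by ext x; exact LinearMap.congr_fun hf x))

/-- This lets elements of the colimit defining local cohomology be represented, and compared, at a
finite stage. -/
instance : PreservesFilteredColimitsOfSize.{0, 0} (forget (ModuleCat.{u} R)) :=
  preservesFilteredColimitsOfSize_shrink.{0, u, 0, u} _

instance (i : ℕ) (A : ModuleCat.{u} R) :
    PreservesColimit (extDiagram J i ⋙ (evaluation (ModuleCat R) (ModuleCat R)).obj A)
      (forget (ModuleCat R)) :=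
  (PreservesFilteredColimitsOfSize.preserves_filtered_colimits (F := forget (ModuleCat.{u} R))
    (ℕᵒᵖ)ᵒᵖ).preservesColimit

lemma trans_cocycle {i : ℕ} {t t' : ℕ} (h : t ≤ t') (f : Res J t i →ₗ[R] A)
    (hf : f ∘ₗ dRes J t (i + 1) i = 0) : (f ∘ₗ trans J h i) ∘ₗ dRes J t' (i + 1) i = 0 := by
  rw [LinearMap.comp_assoc, trans_comp_dRes, ← LinearMap.comp_assoc, hf, LinearMap.zero_comp]

lemma map_diagram_extClass {i : ℕ} {t t' : ℕ} (w : (op (op t) : (ℕᵒᵖ)ᵒᵖ) ⟶ op (op t')) (h : t ≤ t')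
    (f : Res J t i →ₗ[R] A)
    (hf : f ∘ₗ dRes J t (i + 1) i = 0) :
    (((extDiagram J i).map w).app (ModuleCat.of R A)).hom
      (ExtCocycle.extClass (resolution J t) (Y := ModuleCat.of R A) (n := i)
    (ModuleCat.ofHom f) (by ext x; exact LinearMap.congr_fun hf x)) =
    (ExtCocycle.extClass (resolution J t') (Y := ModuleCat.of R A) (n := i)
    (ModuleCat.ofHom (f ∘ₗ trans J h i))
      (by ext x; exact LinearMap.congr_fun (trans_cocycle J h f hf) x)) :=
  ExtCocycle.map_extClass_left _ _ _ _ (ModuleCat.ofHom (projPow J h)) (transComplex J h)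
    (ProjectiveResolution.lift_commutes_zero _ _ _)

lemma cl_trans {i : ℕ} {t t' : ℕ} (h : t ≤ t') (f : Res J t i →ₗ[R] A)
    (hf : f ∘ₗ dRes J t (i + 1) i = 0) :
    cl J t' (f ∘ₗ trans J h i) (trans_cocycle J h f hf) = cl J t f hf := by
  rw [cl, ← map_diagram_extClass J (homOfLE h).op.op h f hf]
  have := (((evaluation _ _).obj (ModuleCat.of R A)).mapCocone
      (colimit.cocone (extDiagram J i))).w (homOfLE h).op.op
  exact congrArg (fun k => k.hom (ExtCocycle.extClass (resolution J t)
    (Y := ModuleCat.of R A) (n := i) (ModuleCat.ofHom f)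
      (by ext x; exact LinearMap.congr_fun hf x))) this

lemma exists_cl_eq {i : ℕ} (x : LC J i A) : ∃ t f hf, x = cl J (i := i) (A := A) t f hf := by
  obtain ⟨⟨⟨t⟩⟩, y, hy⟩ := Concrete.isColimit_exists_rep _ (inclIsColimit J i A) x
  obtain ⟨f, hf, h⟩ := ExtCocycle.exists_extClass_eq (resolution J t) y
  refine ⟨t, f.hom, ?_, ?_⟩
  · exact congrArg ModuleCat.Hom.hom hf
  · rw [← hy, h]; rfl

/-- An element of a filtered colimit vanishes exactly when it already vanishes at a later stage,
where vanishing in Ext means being a coboundary. -/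
lemma cl_eq_zero_iff {i : ℕ} {t : ℕ} (f : Res J t i →ₗ[R] A)
    (hf : f ∘ₗ dRes J t (i + 1) i = 0) :
    cl J t f hf = 0 ↔ ∃ (t' : ℕ) (h : t ≤ t') (j : ℕ) (g : Res J t' j →ₗ[R] A),
      f ∘ₗ trans J h i = g ∘ₗ dRes J t' i j := by
  constructor
  · intro h0
    have h1 : cl J t f hf = (incl J t i A).hom 0 := by rw [h0, map_zero]
    obtain ⟨⟨⟨t'⟩⟩, w, w', hw⟩ :=
      (Concrete.isColimit_rep_eq_iff_exists _ (inclIsColimit J i A) _ _).1 h1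
    have h : t ≤ t' := leOfHom w.unop.unop
    refine ⟨t', h, ?_⟩
    have h2 := map_diagram_extClass J w h f hf
    rw [show w' = w from Subsingleton.elim _ _] at hw
    have h3 := h2.symm.trans (hw.trans (map_zero _))
    obtain ⟨j, g, hg⟩ := (ExtCocycle.extClass_eq_zero_iff _ _ _).1 h3
    exact ⟨j, g.hom, congrArg ModuleCat.Hom.hom hg⟩
  · rintro ⟨t', h, j, g, hg⟩
    rw [← cl_trans J h, cl, (ExtCocycle.extClass_eq_zero_iff _ _ _).2, map_zero]
    exact ⟨j, ModuleCat.ofHom g, by ext x; exact LinearMap.congr_fun hg x⟩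

lemma map_cl {i t : ℕ} (f : Res J t i →ₗ[R] A) (hf : f ∘ₗ dRes J t (i + 1) i = 0)
    (φ : A →ₗ[R] B) : map J i φ (cl J t f hf) =
      cl J t (φ ∘ₗ f) (by rw [LinearMap.comp_assoc, hf, LinearMap.comp_zero]) := by
  have h := (colimit.ι (extDiagram J i) (op (op t))).naturality (ModuleCat.ofHom φ)
  have h1 := congrArg (fun k => k.hom (ExtCocycle.extClass (resolution J t)
    (Y := ModuleCat.of R A) (n := i) (ModuleCat.ofHom f)
      (by ext x; exact LinearMap.congr_fun hf x))) h
  refine h1.symm.trans ?_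
  exact congrArg (incl J t i B).hom (ExtCocycle.map_extClass (resolution J t) _ _ _)

lemma cl_add {i t : ℕ} (f g : Res J t i →ₗ[R] A) (hf : f ∘ₗ dRes J t (i + 1) i = 0)
    (hg : g ∘ₗ dRes J t (i + 1) i = 0) :
    cl J t (f + g) (by rw [LinearMap.add_comp, hf, hg, add_zero]) =
      cl J t f hf + cl J t g hg := by
  rw [cl, cl, cl, ← map_add, ← ExtCocycle.extClass_add]
  rfl

lemma cl_smul {i t : ℕ} (r : R) (f : Res J t i →ₗ[R] A) (hf : f ∘ₗ dRes J t (i + 1) i = 0) :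
    cl J t (r • f) (by rw [LinearMap.smul_comp, hf, smul_zero]) = r • cl J t f hf := by
  rw [cl, cl, ← map_smul, ← ExtCocycle.extClass_smul]
  rfl

end LocCoh

/-! ### Functoriality and the long exact sequence. -/

namespace LocCoh

section LinearAlgebra

variable {R : Type*} [CommRing R]

lemma exists_comp_eq_of_exact {A B C P : Type*} [AddCommGroup A] [Module R A] [AddCommGroup B]
    [Module R B] [AddCommGroup C] [Module R C] [AddCommGroup P] [Module R P]
    {f : A →ₗ[R] B} {g : B →ₗ[R] C} (hf : Function.Injective f) (hfg : Function.Exact f g)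
    (φ : P →ₗ[R] B) (h : g ∘ₗ φ = 0) : ∃ v : P →ₗ[R] A, f ∘ₗ v = φ := by
  have hr : ∀ x, φ x ∈ LinearMap.range f := fun x =>
    (hfg (φ x)).1 (LinearMap.congr_fun h x)
  refine ⟨(LinearEquiv.ofInjective f hf).symm.toLinearMap ∘ₗ φ.codRestrict _ hr, ?_⟩
  ext x
  have := LinearEquiv.apply_symm_apply (LinearEquiv.ofInjective f hf) (φ.codRestrict _ hr x)
  exact congrArg Subtype.val this

lemma comp_eq_zero_of_exact {A B C : Type*} [AddCommGroup A] [Module R A] [AddCommGroup B]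
    [Module R B] [AddCommGroup C] [Module R C] {f : A →ₗ[R] B} {g : B →ₗ[R] C}
    (hfg : Function.Exact f g) : g ∘ₗ f = 0 :=
  LinearMap.ext hfg.apply_apply_eq_zero

lemma cancel_injective_comp {A B P : Type*} [AddCommGroup A] [Module R A] [AddCommGroup B]
    [Module R B] [AddCommGroup P] [Module R P]
    {f : A →ₗ[R] B} (hf : Function.Injective f) {v w : P →ₗ[R] A} (h : f ∘ₗ v = f ∘ₗ w) : v = w :=
  LinearMap.ext fun x => hf (LinearMap.congr_fun h x)

end LinearAlgebra

variable {R : Type u} [CommRing R] (J : Ideal R)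
variable {A B C : Type u} [AddCommGroup A] [Module R A] [AddCommGroup B] [Module R B]
  [AddCommGroup C] [Module R C]

lemma cl_congr {i t : ℕ} {f g : Res J t i →ₗ[R] A} (h : f = g)
    (hf : f ∘ₗ dRes J t (i + 1) i = 0) : cl J t f hf = cl J t g (h ▸ hf) := by
  subst h; rfl

lemma map_comp (i : ℕ) (f : A →ₗ[R] B) (g : B →ₗ[R] C) (x : LC J i A) :
    map J i (g ∘ₗ f) x = map J i g (map J i f x) := by
  obtain ⟨t, h, hh, rfl⟩ := exists_cl_eq J x
  simp only [map_cl, LinearMap.comp_assoc]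

lemma map_smul_id (i : ℕ) (r : R) (x : LC J i A) :
    map J i (r • (LinearMap.id : A →ₗ[R] A)) x = r • x := by
  obtain ⟨t, h, hh, rfl⟩ := exists_cl_eq J x
  rw [map_cl, ← cl_smul]
  exact cl_congr J (by ext; simp) _

lemma map_id (i : ℕ) (x : LC J i A) : map J i (LinearMap.id : A →ₗ[R] A) x = x := by
  simpa using map_smul_id J i 1 x

lemma map_zero_hom (i : ℕ) (x : LC J i A) : map J i (0 : A →ₗ[R] B) x = 0 := by
  have := map_comp J i (0 : A →ₗ[R] A) (0 : A →ₗ[R] B) x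
  rw [LinearMap.comp_zero] at this
  have h2 := map_smul_id J i 0 x
  rw [zero_smul, zero_smul] at h2
  rw [this, h2, map_zero]

lemma map_add_hom (i : ℕ) (f g : A →ₗ[R] B) (x : LC J i A) :
    map J i (f + g) x = map J i f x + map J i g x := by
  obtain ⟨t, h, hh, rfl⟩ := exists_cl_eq J x
  rw [map_cl, map_cl, map_cl, ← cl_add]
  exact cl_congr J (LinearMap.add_comp _ _ _) _

lemma map_sum_hom (i : ℕ) {ι : Type*} (s : Finset ι) (f : ι → A →ₗ[R] B) (x : LC J i A) :
    map J i (∑ k ∈ s, f k) x = ∑ k ∈ s, map J i (f k) x := by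
  classical
  induction s using Finset.induction_on with
  | empty => simp [map_zero_hom]
  | insert a s ha ih => rw [Finset.sum_insert ha, Finset.sum_insert ha, map_add_hom, ih]

lemma cl_dRes_eq_zero {i t j : ℕ} (g : Res J t j →ₗ[R] A)
    (hf : (g ∘ₗ dRes J t i j) ∘ₗ dRes J t (i + 1) i = 0) :
    cl J t (g ∘ₗ dRes J t i j) hf = 0 := by
  rw [cl_eq_zero_iff]
  refine ⟨t, le_rfl, j, g ∘ₗ trans J le_rfl j, ?_⟩
  rw [LinearMap.comp_assoc, LinearMap.comp_assoc, trans_comp_dRes]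

lemma exists_coboundary_of_cl_eq_zero {i t : ℕ} (f : Res J t (i + 1) →ₗ[R] A)
    (hf : f ∘ₗ dRes J t (i + 1 + 1) (i + 1) = 0) (h0 : cl J t f hf = 0) :
    ∃ (t' : ℕ) (h : t ≤ t') (g : Res J t' i →ₗ[R] A),
      f ∘ₗ trans J h (i + 1) = g ∘ₗ dRes J t' (i + 1) i := by
  obtain ⟨t', h, j, g, hg⟩ := (cl_eq_zero_iff J f hf).1 h0
  by_cases hj : j = i
  · subst hj
    exact ⟨t', h, g, hg⟩
  -- For any other `j` the differential is zero, so the restricted cocycle is itself zero.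
  · refine ⟨t', h, 0, ?_⟩
    rw [hg, dRes_eq_zero J t' (by omega)]
    simp

lemma trans_eq_zero_of_cl_eq_zero {t : ℕ} (f : Res J t 0 →ₗ[R] A)
    (hf : f ∘ₗ dRes J t (0 + 1) 0 = 0) (h0 : cl J t f hf = 0) :
    ∃ (t' : ℕ) (h : t ≤ t'), f ∘ₗ trans J h 0 = 0 := by
  obtain ⟨t', h, j, g, hg⟩ := (cl_eq_zero_iff J f hf).1 h0
  refine ⟨t', h, ?_⟩
  rw [hg, dRes_eq_zero J t' (by omega), LinearMap.comp_zero]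

lemma map_zero_injective (f : A →ₗ[R] B) (hf : Function.Injective f) :
    Function.Injective (map J 0 f) := by
  rw [injective_iff_map_eq_zero]
  intro x hx
  obtain ⟨t, h, hh, rfl⟩ := exists_cl_eq J x
  rw [map_cl] at hx
  obtain ⟨t', ht, h0⟩ := trans_eq_zero_of_cl_eq_zero J _ _ hx
  rw [← cl_trans J ht, cl_eq_zero_iff]
  refine ⟨t', le_rfl, 0, 0, ?_⟩
  rw [show h ∘ₗ trans J ht 0 = 0 from cancel_injective_comp hf (by
    rw [← LinearMap.comp_assoc, h0, LinearMap.comp_zero])]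
  simp

section LongExactSequence

variable {f : A →ₗ[R] B} {g : B →ₗ[R] C}

/-- A cocycle with values in `B` whose image in `C` is cohomologically trivial comes from a
cocycle with values in `A` up to a coboundary. -/
lemma exists_of_cl_comp_eq_zero (hf : Function.Injective f) (hg : Function.Surjective g)
    (hfg : Function.Exact f g) {i t : ℕ} (h : Res J t i →ₗ[R] B)
    (hh : (g ∘ₗ h) ∘ₗ dRes J t (i + 1) i = 0) (h0 : cl J t (g ∘ₗ h) hh = 0) :
    ∃ (t' : ℕ) (ht : t ≤ t') (j : ℕ) (s : Res J t' j →ₗ[R] B) (v : Res J t' i →ₗ[R] A),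
      h ∘ₗ trans J ht i = s ∘ₗ dRes J t' i j + f ∘ₗ v := by
  obtain ⟨t', ht, j, s, hs⟩ := (cl_eq_zero_iff J _ _).1 h0
  obtain ⟨s', hs'⟩ := Module.projective_lifting_property g s hg
  obtain ⟨v, hv⟩ := exists_comp_eq_of_exact hf hfg (h ∘ₗ trans J ht i - s' ∘ₗ dRes J t' i j) (by
    rw [LinearMap.comp_sub, ← LinearMap.comp_assoc, ← LinearMap.comp_assoc, hs', hs, sub_self])
  exact ⟨t', ht, j, s', v, by rw [hv]; abel⟩

lemma map_exact (hf : Function.Injective f) (hg : Function.Surjective g)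
    (hfg : Function.Exact f g) (i : ℕ) : Function.Exact (map J i f) (map J i g) := by
  intro x
  constructor
  · intro hx
    obtain ⟨t, h, hh, rfl⟩ := exists_cl_eq J x
    rw [map_cl] at hx
    obtain ⟨t', ht, j, s, v, hv⟩ := exists_of_cl_comp_eq_zero J hf hg hfg h _ hx
    have hs : (s ∘ₗ dRes J t' i j) ∘ₗ dRes J t' (i + 1) i = 0 := by
      rw [LinearMap.comp_assoc, dRes_comp_dRes, LinearMap.comp_zero]
    have hv' : (f ∘ₗ v) ∘ₗ dRes J t' (i + 1) i = 0 := by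
      have := trans_cocycle J ht h hh
      rwa [hv, LinearMap.add_comp, hs, zero_add] at this
    have hv0 : v ∘ₗ dRes J t' (i + 1) i = 0 := cancel_injective_comp hf (by
      rw [← LinearMap.comp_assoc, hv', LinearMap.comp_zero])
    refine ⟨cl J t' v hv0, ?_⟩
    rw [map_cl, ← cl_trans J ht h hh, cl_congr J hv, cl_add J _ _ hs hv', cl_dRes_eq_zero,
      zero_add]
  · rintro ⟨a, rfl⟩
    rw [← map_comp, comp_eq_zero_of_exact hfg, map_zero_hom]

variable (f g) in
/-- The graph of the connecting homomorphism. -/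
def deltaGraph (i : ℕ) : Submodule R (LC J i C × LC J (i + 1) A) where
  carrier := {p | ∃ (t : ℕ) (h : Res J t i →ₗ[R] B) (u : Res J t (i + 1) →ₗ[R] A)
    (_ : h ∘ₗ dRes J t (i + 1) i = f ∘ₗ u) (h2 : (g ∘ₗ h) ∘ₗ dRes J t (i + 1) i = 0)
    (h3 : u ∘ₗ dRes J t (i + 1 + 1) (i + 1) = 0), p = (cl J t (g ∘ₗ h) h2, cl J t u h3)}
  zero_mem' := by
    refine ⟨0, 0, 0, by simp, by simp, by simp, ?_⟩
    rw [(cl_eq_zero_iff J _ _).2 ⟨0, le_rfl, 0, 0, by simp⟩,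
      (cl_eq_zero_iff J _ _).2 ⟨0, le_rfl, 0, 0, by simp⟩]
    rfl
  add_mem' := by
    rintro _ _ ⟨t, h, u, h1, h2, h3, rfl⟩ ⟨t', h', u', h1', h2', h3', rfl⟩
    have hl := le_max_left t t'
    have hr := le_max_right t t'
    have hc : (g ∘ₗ (h ∘ₗ trans J hl i + h' ∘ₗ trans J hr i)) ∘ₗ
        dRes J (max t t') (i + 1) i = 0 := by
      rw [LinearMap.comp_add, LinearMap.add_comp, ← LinearMap.comp_assoc, ← LinearMap.comp_assoc,
        trans_cocycle J hl _ h2, trans_cocycle J hr _ h2', add_zero]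
    refine ⟨max t t', h ∘ₗ trans J hl i + h' ∘ₗ trans J hr i,
      u ∘ₗ trans J hl (i + 1) + u' ∘ₗ trans J hr (i + 1), ?_, hc, ?_, ?_⟩
    · rw [LinearMap.add_comp, LinearMap.comp_add, LinearMap.comp_assoc, LinearMap.comp_assoc,
        trans_comp_dRes, trans_comp_dRes, ← LinearMap.comp_assoc, ← LinearMap.comp_assoc, h1, h1']
      rfl
    · rw [LinearMap.add_comp, trans_cocycle J hl _ h3, trans_cocycle J hr _ h3', add_zero]
    · rw [Prod.mk_add_mk, ← cl_trans J hl _ h2, ← cl_trans J hr _ h2', ← cl_add,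
        ← cl_trans J hl _ h3, ← cl_trans J hr _ h3', ← cl_add]
      exact Prod.ext (cl_congr J (by
        rw [LinearMap.comp_add, ← LinearMap.comp_assoc, ← LinearMap.comp_assoc]) hc).symm rfl
  smul_mem' := by
    rintro r _ ⟨t, h, u, h1, h2, h3, rfl⟩
    have hc : (g ∘ₗ (r • h)) ∘ₗ dRes J t (i + 1) i = 0 := by
      rw [LinearMap.comp_smul, LinearMap.smul_comp, h2, smul_zero]
    refine ⟨t, r • h, r • u, ?_, hc, ?_, ?_⟩
    · rw [LinearMap.smul_comp, h1, LinearMap.comp_smul]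
    · rw [LinearMap.smul_comp, h3, smul_zero]
    · rw [Prod.smul_mk, ← cl_smul, ← cl_smul]
      exact Prod.ext (cl_congr J (by rw [LinearMap.comp_smul]) hc).symm rfl

/-- This makes the relation a function. Existence: projectivity of the resolution lifts a cocycle
from `C` to `B`, and its coboundary falls into `A`. Uniqueness: if the class in `C` dies, the lift
is a coboundary plus a cochain from `A` at a later stage, and that cochain bounds `u`. -/
lemma deltaGraph_fst_bijective (hf : Function.Injective f) (hg : Function.Surjective g)
    (hfg : Function.Exact f g) (i : ℕ) :
    Function.Bijective (LinearMap.fst R _ _ ∘ₗ (deltaGraph J f g i).subtype) := by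
  constructor
  · rw [injective_iff_map_eq_zero]
    rintro ⟨_, t, h, u, h1, h2, h3, rfl⟩ (h0 : cl J t (g ∘ₗ h) h2 = 0)
    obtain ⟨t', ht, j, s, v, hv⟩ := exists_of_cl_comp_eq_zero J hf hg hfg h _ h0
    have hu : u ∘ₗ trans J ht (i + 1) = v ∘ₗ dRes J t' (i + 1) i := by
      apply cancel_injective_comp hf
      rw [← LinearMap.comp_assoc, ← h1, LinearMap.comp_assoc, ← trans_comp_dRes,
        ← LinearMap.comp_assoc, hv, LinearMap.add_comp, LinearMap.comp_assoc, dRes_comp_dRes,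
        LinearMap.comp_zero, zero_add, LinearMap.comp_assoc]
    have hu0 : cl J t u h3 = 0 := (cl_eq_zero_iff J _ _).2 ⟨t', ht, i, v, hu⟩
    exact Subtype.ext (Prod.ext h0 hu0)
  · intro c
    obtain ⟨t, k, hk, rfl⟩ := exists_cl_eq J c
    obtain ⟨h, rfl⟩ := Module.projective_lifting_property g k hg
    obtain ⟨u, hu⟩ := exists_comp_eq_of_exact hf hfg (h ∘ₗ dRes J t (i + 1) i) (by
      rw [← LinearMap.comp_assoc, hk])
    refine ⟨⟨(_, cl J t u ?_), t, h, u, hu.symm, hk, ?_, rfl⟩, rfl⟩ <;>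
    exact cancel_injective_comp hf (by
      rw [← LinearMap.comp_assoc, hu, LinearMap.comp_assoc, dRes_comp_dRes]; simp)

/-- The connecting homomorphism of the long exact sequence of local cohomology. -/
def delta (hf : Function.Injective f) (hg : Function.Surjective g)
    (hfg : Function.Exact f g) (i : ℕ) : LC J i C →ₗ[R] LC J (i + 1) A :=
  (LinearMap.snd R _ _ ∘ₗ (deltaGraph J f g i).subtype) ∘ₗ
    (LinearEquiv.ofBijective _ (deltaGraph_fst_bijective J hf hg hfg i)).symm.toLinearMap

lemma delta_eq_iff (hf : Function.Injective f) (hg : Function.Surjective g)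
    (hfg : Function.Exact f g) (i : ℕ) (c : LC J i C) (a : LC J (i + 1) A) :
    delta J hf hg hfg i c = a ↔ (c, a) ∈ deltaGraph J f g i := by
  let e := LinearEquiv.ofBijective _ (deltaGraph_fst_bijective J hf hg hfg i)
  have he : ∀ p, e p = p.1.1 := fun p => rfl
  constructor
  · rintro rfl
    have : (c, delta J hf hg hfg i c) = (e.symm c).1 := by
      refine Prod.ext ?_ rfl
      rw [← he, LinearEquiv.apply_symm_apply]
    rw [this]
    exact (e.symm c).2
  · intro h
    have : e.symm c = ⟨(c, a), h⟩ := by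
      rw [LinearEquiv.symm_apply_eq]; rfl
    change (e.symm c).1.2 = a
    rw [this]

variable (hf : Function.Injective f) (hg : Function.Surjective g) (hfg : Function.Exact f g)

include hf hg hfg in
lemma exact_map_delta (i : ℕ) : Function.Exact (map J i g) (delta J hf hg hfg i) := by
  intro c
  rw [delta_eq_iff]
  constructor
  · rintro ⟨t, h, u, h1, h2, h3, hp⟩
    obtain ⟨rfl, hu⟩ := Prod.ext_iff.1 hp
    obtain ⟨t', ht, s, hs⟩ := exists_coboundary_of_cl_eq_zero J _ h3 hu.symm
    -- Subtracting the primitive of `u` turns the lift into a cocycle without changing its image in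
    -- `C`.
    refine ⟨cl J t' (h ∘ₗ trans J ht i - f ∘ₗ s) ?_, ?_⟩
    · rw [LinearMap.sub_comp, LinearMap.comp_assoc, trans_comp_dRes, ← LinearMap.comp_assoc, h1,
        LinearMap.comp_assoc, hs]
      exact sub_self _
    · rw [map_cl, ← cl_trans J ht (g ∘ₗ h) h2]
      refine cl_congr J ?_ _
      rw [LinearMap.comp_sub, ← LinearMap.comp_assoc, ← LinearMap.comp_assoc,
        comp_eq_zero_of_exact hfg, LinearMap.zero_comp, sub_zero]
  · rintro ⟨b, rfl⟩
    obtain ⟨t, h, hh, rfl⟩ := exists_cl_eq J b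
    refine ⟨t, h, 0, by rw [hh, LinearMap.comp_zero],
      by rw [LinearMap.comp_assoc, hh, LinearMap.comp_zero], by simp, ?_⟩
    rw [map_cl, (cl_eq_zero_iff J (0 : Res J t (i + 1) →ₗ[R] A) _).2 ⟨t, le_rfl, 0, 0, by simp⟩]

include hf hg hfg in
lemma exact_delta_map (i : ℕ) : Function.Exact (delta J hf hg hfg i) (map J (i + 1) f) := by
  intro a
  constructor
  · intro ha
    obtain ⟨t, u, hu, rfl⟩ := exists_cl_eq J a
    rw [map_cl] at ha
    obtain ⟨t', ht, s, hs⟩ := exists_coboundary_of_cl_eq_zero J _ _ ha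
    have h2 : (g ∘ₗ s) ∘ₗ dRes J t' (i + 1) i = 0 := by
      rw [LinearMap.comp_assoc, ← hs, LinearMap.comp_assoc, ← LinearMap.comp_assoc,
        comp_eq_zero_of_exact hfg, LinearMap.zero_comp]
    refine ⟨cl J t' (g ∘ₗ s) h2, ?_⟩
    rw [delta_eq_iff, ← cl_trans J ht u hu]
    exact ⟨t', s, u ∘ₗ trans J ht (i + 1), hs.symm, h2, _, rfl⟩
  · rintro ⟨c, rfl⟩
    obtain ⟨t, h, u, h1, h2, h3, hp⟩ := (delta_eq_iff J hf hg hfg i c _).1 rfl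
    rw [show delta J hf hg hfg i c = _ from (Prod.ext_iff.1 hp).2, map_cl, cl_congr J h1.symm, cl_dRes_eq_zero]

lemma delta_naturality {A' B' C' : Type u} [AddCommGroup A'] [Module R A'] [AddCommGroup B']
    [Module R B'] [AddCommGroup C'] [Module R C'] {f' : A' →ₗ[R] B'} {g' : B' →ₗ[R] C'}
    (hf' : Function.Injective f') (hg' : Function.Surjective g') (hfg' : Function.Exact f' g')
    (α : A →ₗ[R] A') (β : B →ₗ[R] B') (γ : C →ₗ[R] C') (h1 : β ∘ₗ f = f' ∘ₗ α)
    (h2 : γ ∘ₗ g = g' ∘ₗ β) (i : ℕ) (c : LC J i C) :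
    delta J hf' hg' hfg' i (map J i γ c) = map J (i + 1) α (delta J hf hg hfg i c) := by
  obtain ⟨t, h, u, k1, k2, k3, hp⟩ := (delta_eq_iff J hf hg hfg i c _).1 rfl
  obtain ⟨hc, hd⟩ := Prod.ext_iff.1 hp
  rw [delta_eq_iff, show delta J hf hg hfg i c = _ from hd, show c = _ from hc]
  refine ⟨t, β ∘ₗ h, α ∘ₗ u, ?_, ?_, ?_, ?_⟩
  · rw [LinearMap.comp_assoc, k1, ← LinearMap.comp_assoc, h1, LinearMap.comp_assoc]
  · rw [← LinearMap.comp_assoc, ← h2, LinearMap.comp_assoc, LinearMap.comp_assoc,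
      ← LinearMap.comp_assoc (f := dRes J t (i + 1) i), k2, LinearMap.comp_zero]
  · rw [LinearMap.comp_assoc, k3, LinearMap.comp_zero]
  · rw [map_cl, map_cl]
    exact Prod.ext (cl_congr J (by rw [← LinearMap.comp_assoc, h2, LinearMap.comp_assoc])
      (by rw [LinearMap.comp_assoc, k2, LinearMap.comp_zero])) rfl

end LongExactSequence

end LocCoh

/-! ### Power torsion modules: degree zero and vanishing in positive degrees. -/

namespace LocCoh

variable {R : Type u} [CommRing R] (J : Ideal R)

/-- Every element is annihilated by some power of `J`. -/
def IsPowTorsion (N : Type*) [AddCommGroup N] [Module R N] : Prop :=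
  ∀ x : N, ∃ t : ℕ, ∀ r ∈ J ^ t, r • x = 0

section Torsion

variable {J} {N N' : Type*} [AddCommGroup N] [Module R N] [AddCommGroup N'] [Module R N']

lemma IsPowTorsion.of_injective (h : IsPowTorsion J N') (f : N →ₗ[R] N')
    (hf : Function.Injective f) : IsPowTorsion J N := by
  intro x
  obtain ⟨t, ht⟩ := h (f x)
  exact ⟨t, fun r hr => hf (by rw [map_smul, ht r hr, map_zero])⟩

lemma IsPowTorsion.of_surjective (h : IsPowTorsion J N) (f : N →ₗ[R] N')
    (hf : Function.Surjective f) : IsPowTorsion J N' := by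
  intro y
  obtain ⟨x, rfl⟩ := hf y
  obtain ⟨t, ht⟩ := h x
  exact ⟨t, fun r hr => by rw [← map_smul, ht r hr, map_zero]⟩

variable (J N) in
/-- The submodule of all elements annihilated by a power of `J`. -/
def powTorsion : Submodule R N where
  carrier := {x | ∃ t : ℕ, ∀ r ∈ J ^ t, r • x = 0}
  zero_mem' := ⟨0, fun r _ => smul_zero r⟩
  add_mem' := by
    rintro x y ⟨s, hs⟩ ⟨t, ht⟩
    refine ⟨max s t, fun r hr => ?_⟩
    rw [smul_add, hs r (Ideal.pow_le_pow_right (le_max_left _ _) hr),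
      ht r (Ideal.pow_le_pow_right (le_max_right _ _) hr), add_zero]
  smul_mem' := by
    rintro c x ⟨t, ht⟩
    exact ⟨t, fun r hr => by rw [smul_comm, ht r hr, smul_zero]⟩

lemma isPowTorsion_powTorsion : IsPowTorsion J (powTorsion J N) := by
  rintro ⟨x, t, ht⟩
  exact ⟨t, fun r hr => Subtype.ext (ht r hr)⟩

lemma IsPowTorsion.exists_pow [Module.Finite R N] (h : IsPowTorsion J N) :
    ∃ t : ℕ, ∀ r ∈ J ^ t, ∀ x : N, r • x = 0 := by
  obtain ⟨s, hs⟩ := (Module.Finite.fg_top : (⊤ : Submodule R N).FG)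
  choose t ht using h
  refine ⟨s.sup t, fun r hr x => ?_⟩
  have hx : x ∈ Submodule.span R (s : Set N) := hs ▸ Submodule.mem_top
  induction hx using Submodule.span_induction with
  | mem y hy => exact ht y r (Ideal.pow_le_pow_right (Finset.le_sup hy) hr)
  | zero => exact smul_zero r
  | add y z _ _ hy hz => rw [smul_add, hy, hz, add_zero]
  | smul a y _ hy => rw [smul_comm, hy, smul_zero]

lemma isPowTorsion_of_pow {t : ℕ} (h : ∀ r ∈ J ^ t, ∀ x : N, r • x = 0) : IsPowTorsion J N :=
  fun x => ⟨t, fun r hr => h r hr x⟩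

end Torsion

section DegreeZero

variable {J} {N : Type u} [AddCommGroup N] [Module R N]

lemma comp_aug_cocycle {t : ℕ} (l : (R ⧸ J ^ t) →ₗ[R] N) :
    (l ∘ₗ aug J t) ∘ₗ dRes J t (0 + 1) 0 = 0 := by
  rw [LinearMap.comp_assoc, comp_eq_zero_of_exact (exact_dRes_aug J t), LinearMap.comp_zero]

lemma aug_trans_comp {t t' : ℕ} (h : t ≤ t') (l : (R ⧸ J ^ t) →ₗ[R] N) :
    (l ∘ₗ aug J t) ∘ₗ trans J h 0 = (l ∘ₗ projPow J h) ∘ₗ aug J t' := by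
  rw [LinearMap.comp_assoc, aug_comp_trans, LinearMap.comp_assoc]

lemma projPow_one {t t' : ℕ} (h : t ≤ t') : projPow J h 1 = 1 := rfl

lemma quot_hom_ext {t : ℕ} {l l' : (R ⧸ J ^ t) →ₗ[R] N} (h : l 1 = l' 1) : l = l' := by
  ext
  exact h

lemma exists_quot_hom {t : ℕ} {a : N} (h : ∀ r ∈ J ^ t, r • a = 0) :
    ∃ l : (R ⧸ J ^ t) →ₗ[R] N, l 1 = a := by
  refine ⟨Submodule.liftQ _ (LinearMap.toSpanSingleton R N a) (fun r hr => h r hr), ?_⟩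
  exact one_smul R a

lemma smul_apply_one {t : ℕ} (l : (R ⧸ J ^ t) →ₗ[R] N) {r : R} (hr : r ∈ J ^ t) :
    r • l 1 = 0 := by
  rw [← map_smul, show r • (1 : R ⧸ J ^ t) = 0 from ?_, map_zero]
  change Ideal.Quotient.mk _ (r * 1) = 0
  rw [mul_one, Ideal.Quotient.eq_zero_iff_mem]
  exact hr

/-- A 0-cocycle kills the image of the first differential, which is the kernel of the augmentation,
so it factors through R / J^t. -/
lemma exists_eq_comp_aug (x : LC J 0 N) :
    ∃ (t : ℕ) (l : (R ⧸ J ^ t) →ₗ[R] N), x = cl J t (l ∘ₗ aug J t) (comp_aug_cocycle l) := by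
  obtain ⟨t, f, hf, rfl⟩ := exists_cl_eq J x
  have hk : LinearMap.ker (aug J t) ≤ LinearMap.ker f := by
    intro p hp
    obtain ⟨q, rfl⟩ := (exact_dRes_aug J t p).1 hp
    exact LinearMap.congr_fun hf q
  let e := LinearMap.quotKerEquivOfSurjective _ (aug_surjective J t)
  refine ⟨t, Submodule.liftQ _ f hk ∘ₗ e.symm.toLinearMap, ?_⟩
  refine cl_congr J ?_ _
  ext p
  have : e.symm (aug J t p) = Submodule.Quotient.mk p := by
    rw [LinearEquiv.symm_apply_eq]; rfl
  simp [this]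

lemma eq_zero_of_cl_aug_eq_zero {t : ℕ} (l : (R ⧸ J ^ t) →ₗ[R] N)
    (h0 : cl J t (l ∘ₗ aug J t) (comp_aug_cocycle l) = 0) : l = 0 := by
  obtain ⟨t', h, h1⟩ := trans_eq_zero_of_cl_eq_zero J _ _ h0
  rw [aug_trans_comp] at h1
  apply quot_hom_ext
  obtain ⟨p, hp⟩ := aug_surjective J t' 1
  have := LinearMap.congr_fun h1 p
  simpa [hp, projPow_one] using this

variable (J N) in
/-- The graph of the isomorphism between a `J`-power torsion module and its zeroth local
cohomology. -/
def zeroGraph : Submodule R (N × LC J 0 N) where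
  carrier := {p | ∃ (t : ℕ) (l : (R ⧸ J ^ t) →ₗ[R] N),
    p = (l 1, cl J t (l ∘ₗ aug J t) (comp_aug_cocycle l))}
  zero_mem' := by
    refine ⟨0, 0, ?_⟩
    rw [(cl_eq_zero_iff J _ _).2 ⟨0, le_rfl, 0, 0, by simp⟩]
    rfl
  add_mem' := by
    rintro _ _ ⟨t, l, rfl⟩ ⟨t', l', rfl⟩
    refine ⟨max t t', l ∘ₗ projPow J (le_max_left t t') + l' ∘ₗ projPow J (le_max_right t t'), ?_⟩
    rw [Prod.mk_add_mk, ← cl_trans J (le_max_left t t'),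
      ← cl_trans J (le_max_right t t') (l' ∘ₗ _), ← cl_add]
    refine Prod.ext rfl (cl_congr J ?_ (comp_aug_cocycle _)).symm
    rw [aug_trans_comp, aug_trans_comp, LinearMap.add_comp]
  smul_mem' := by
    rintro r _ ⟨t, l, rfl⟩
    refine ⟨t, r • l, ?_⟩
    rw [Prod.smul_mk, ← cl_smul]
    rfl

/-- The zeroth local cohomology of a `J`-power torsion module is the module itself. -/
theorem nonempty_zeroEquiv (h : IsPowTorsion J N) : Nonempty (N ≃ₗ[R] LC J 0 N) := by
  -- A map `l` from R / J^t is the same as an element `l 1` killed by J^t; both projections of the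
  -- graph are bijective.
  have h1 : Function.Bijective (LinearMap.fst R _ _ ∘ₗ (zeroGraph J N).subtype) := by
    constructor
    · rw [injective_iff_map_eq_zero]
      rintro ⟨_, t, l, rfl⟩ (h0 : l 1 = 0)
      obtain rfl : l = 0 := quot_hom_ext h0
      refine Subtype.ext (Prod.ext rfl ?_)
      exact (cl_eq_zero_iff J _ (comp_aug_cocycle 0)).2 ⟨t, le_rfl, 0, 0, by simp⟩
    · intro a
      obtain ⟨t, ht⟩ := h a
      obtain ⟨l, rfl⟩ := exists_quot_hom ht
      exact ⟨⟨_, t, l, rfl⟩, rfl⟩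
  have h2 : Function.Bijective (LinearMap.snd R _ _ ∘ₗ (zeroGraph J N).subtype) := by
    constructor
    · rw [injective_iff_map_eq_zero]
      rintro ⟨_, t, l, rfl⟩ (h0 : cl J t _ _ = 0)
      obtain rfl : l = 0 := eq_zero_of_cl_aug_eq_zero l h0
      exact Subtype.ext (Prod.ext rfl h0)
    · intro x
      obtain ⟨t, l, rfl⟩ := exists_eq_comp_aug x
      exact ⟨⟨_, t, l, rfl⟩, rfl⟩
  exact ⟨(LinearEquiv.ofBijective _ h1).symm.trans (LinearEquiv.ofBijective _ h2)⟩

/-- A preimage of `l 1` need not be killed by J^t, but it is killed by some power of `J` because `E`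
is torsion, and the stage may be raised to that power. -/
lemma map_zero_surjective {E : Type u} [AddCommGroup E] [Module R E] (hE : IsPowTorsion J E)
    (g : E →ₗ[R] N) (hg : Function.Surjective g) : Function.Surjective (map J 0 g) := by
  intro x
  obtain ⟨t, l, rfl⟩ := exists_eq_comp_aug x
  obtain ⟨e, he⟩ := hg (l 1)
  obtain ⟨s, hs⟩ := hE e
  obtain ⟨k, hk⟩ := exists_quot_hom (t := max t s) (a := e)
    (fun r hr => hs r (Ideal.pow_le_pow_right (le_max_right _ _) hr))
  refine ⟨cl J _ (k ∘ₗ aug J _) (comp_aug_cocycle k), ?_⟩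
  rw [map_cl, ← cl_trans J (le_max_left t s)]
  refine cl_congr J ?_ _
  rw [aug_trans_comp, ← LinearMap.comp_assoc]
  congr 1
  apply quot_hom_ext
  rw [LinearMap.comp_apply, LinearMap.comp_apply, hk, he, projPow_one]

end DegreeZero

section Injective

variable {J}

lemma exists_extension {A B E : Type u} [AddCommGroup A] [Module R A] [AddCommGroup B] [Module R B]
    [AddCommGroup E] [Module R E] (hE : Module.Injective R E) (d : A →ₗ[R] B) (f : A →ₗ[R] E)
    (h : LinearMap.ker d ≤ LinearMap.ker f) : ∃ g : B →ₗ[R] E, g ∘ₗ d = f := by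
  obtain ⟨g, hg⟩ := hE.out ((LinearMap.ker d).liftQ d le_rfl)
    (LinearMap.ker_eq_bot.1 (Submodule.ker_liftQ_eq_bot _ _ _ le_rfl))
    ((LinearMap.ker d).liftQ f h)
  refine ⟨g, ?_⟩
  ext a
  exact hg (Submodule.Quotient.mk a)

lemma lc_injective_eq_zero {E : Type u} [AddCommGroup E] [Module R E]
    (hE : Module.Injective R E) (i : ℕ) (x : LC J (i + 1) E) : x = 0 := by
  obtain ⟨t, f, hf, rfl⟩ := exists_cl_eq J x
  obtain ⟨g, rfl⟩ := exists_extension hE (dRes J t (i + 1) i) f (by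
    intro p hp
    obtain ⟨q, rfl⟩ := (dRes_exact J t i p).1 hp
    exact LinearMap.congr_fun hf q)
  exact cl_dRes_eq_zero J g _

/-- Over a Noetherian ring, the `J`-power torsion of an injective module is injective. -/
lemma injective_powTorsion [IsNoetherianRing R] {E : Type u} [AddCommGroup E] [Module R E]
    (hE : Module.Injective R E) : Module.Injective R (powTorsion J E) := by
  apply Module.Baer.injective
  intro I g
  have hfin : Module.Finite R I := Module.IsNoetherian.finite R I
  obtain ⟨s, hs⟩ := (isPowTorsion_powTorsion.of_injective (LinearMap.range g).subtype
    (Submodule.injective_subtype _)).exists_pow (J := J) (N := LinearMap.range g)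
  -- Artin–Rees: I ∩ J^(k+s) ⊆ J^s I, which `g` kills because J^s annihilates its finitely generated
  -- image.
  obtain ⟨k, hk⟩ := Ideal.exists_pow_inf_eq_pow_smul J (M := R) I
  have hle : ∀ x (hx : x ∈ I), x ∈ J ^ (k + s) → g ⟨x, hx⟩ = 0 := by
    intro x hx hxJ
    have h1 : x ∈ (J ^ (k + s) • (⊤ : Submodule R R)) ⊓ I := by
      refine ⟨?_, hx⟩
      simpa using hxJ
    rw [hk (k + s) (by omega), Nat.add_sub_cancel_left] at h1
    have h2 : x ∈ J ^ s • I := Submodule.smul_mono le_rfl inf_le_right h1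
    have h3 : ∀ y ∈ J ^ s • I, ∀ hy : y ∈ I, g ⟨y, hy⟩ = 0 := by
      intro y hy
      induction hy using Submodule.smul_induction_on' with
      | smul r hr n hn =>
        intro hy
        have := hs r hr ⟨g ⟨n, hn⟩, LinearMap.mem_range_self _ _⟩
        have h4 : r • g ⟨n, hn⟩ = 0 := congrArg Subtype.val this
        rw [← h4, ← map_smul]
        rfl
      | add y hy z hz h1 h2 =>
        intro hyz
        have hy' : y ∈ I := Submodule.smul_le_right hy
        have hz' : z ∈ I := Submodule.smul_le_right hz
        have : (⟨y + z, hyz⟩ : I) = ⟨y, hy'⟩ + ⟨z, hz'⟩ := rfl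
        rw [this, map_add, h1 hy', h2 hz', add_zero]
    exact h3 x h2 hx
  -- Extending from the image of `I` in R / J^(k+s), rather than from `I` itself, forces the values
  -- of the extension to be J-power torsion.
  obtain ⟨l, hl⟩ := exists_extension hE
    ((J ^ (k + s)).mkQ ∘ₗ I.subtype) ((powTorsion J E).subtype ∘ₗ g) (by
      rintro ⟨x, hx⟩ h
      have : x ∈ J ^ (k + s) := (Submodule.Quotient.mk_eq_zero _).1 h
      simp [hle x hx this])
  refine ⟨(l ∘ₗ (J ^ (k + s)).mkQ).codRestrict _ (fun x => ?_), fun x hx => ?_⟩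
  · have : (l ∘ₗ (J ^ (k + s)).mkQ) x = x • l 1 := by
      rw [← map_smul]
      refine congrArg l ?_
      change Ideal.Quotient.mk _ x = Ideal.Quotient.mk _ (x * 1)
      rw [mul_one]
    rw [this]
    exact (powTorsion J E).smul_mem x ⟨k + s, fun r hr => smul_apply_one l hr⟩
  · exact Subtype.ext (LinearMap.congr_fun hl ⟨x, hx⟩)

lemma exists_injective_embedding (N : Type u) [AddCommGroup N] [Module R N] :
    ∃ (E : ModuleCat.{u} R) (ι : N →ₗ[R] E), Module.Injective R E ∧ Function.Injective ι := by
  have : CategoryTheory.Mono (CategoryTheory.Injective.ι (ModuleCat.of R N)) := inferInstance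
  refine ⟨CategoryTheory.Injective.under (ModuleCat.of R N),
    (CategoryTheory.Injective.ι (ModuleCat.of R N)).hom, ?_,
    (ModuleCat.mono_iff_injective _).1 this⟩
  have : CategoryTheory.Injective (CategoryTheory.Injective.under (ModuleCat.of R N)) :=
    inferInstance
  exact (Module.injective_iff_injective_object R _).2 this

/-- Higher local cohomology of a `J`-power torsion module vanishes. -/
theorem lc_succ_eq_zero [IsNoetherianRing R] (i : ℕ) (N : Type u) [AddCommGroup N] [Module R N]
    (hN : IsPowTorsion J N) (x : LC J (i + 1) N) : x = 0 := by
  induction i generalizing N with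
  | zero => ?_
  | succ i ih => ?_
  all_goals
    obtain ⟨E₀, ι₀, hE₀, hι₀⟩ := exists_injective_embedding (R := R) N
    -- Passing to the torsion part keeps the cokernel of the embedding torsion, so dimension
    -- shifting stays among torsion modules.
    let E := powTorsion J E₀
    have hE : Module.Injective R E := injective_powTorsion hE₀
    let ι : N →ₗ[R] E := ι₀.codRestrict _ (fun y => by
      obtain ⟨t, ht⟩ := hN y
      exact ⟨t, fun r hr => by rw [← map_smul, ht r hr, map_zero]⟩)
    have hι : Function.Injective ι := fun a b h => hι₀ (congrArg Subtype.val h)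
    have hex : Function.Exact ι (LinearMap.range ι).mkQ := LinearMap.exact_map_mkQ_range ι
    have hsur : Function.Surjective (LinearMap.range ι).mkQ := Submodule.mkQ_surjective _
    have htor : IsPowTorsion J (E ⧸ LinearMap.range ι) :=
      isPowTorsion_powTorsion.of_surjective _ hsur
    obtain ⟨c, rfl⟩ := (exact_delta_map J hι hsur hex _ x).1 (lc_injective_eq_zero hE _ _)
  · obtain ⟨e, rfl⟩ := map_zero_surjective isPowTorsion_powTorsion _ hsur c
    exact (exact_map_delta J hι hsur hex 0).apply_apply_eq_zero e
  · rw [ih _ htor c, map_zero]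

end Injective

end LocCoh

/-! ### Reduction modulo one parameter. -/

namespace LocCoh

section ZeroColon

variable {R : Type*} [CommRing R] (I : Ideal R) {A B C : Type*} [AddCommGroup A] [Module R A]
  [AddCommGroup B] [Module R B] [AddCommGroup C] [Module R C]

lemma mem_zeroColon {x : A} : x ∈ GenCM.zeroColon A I ↔ ∀ r ∈ I, r • x = 0 := by
  rw [Submodule.mem_torsionBySet_iff]
  exact ⟨fun h r hr => h ⟨r, hr⟩, fun h r => h r.1 r.2⟩

/-- The restriction of a linear map to the elements annihilated by an ideal. -/
def zeroColonMap (f : A →ₗ[R] B) : GenCM.zeroColon A I →ₗ[R] GenCM.zeroColon B I :=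
  f.restrict fun x hx => by
    rw [mem_zeroColon] at hx ⊢
    intro r hr
    rw [← map_smul, hx r hr, map_zero]

/-- The restriction of a linear equivalence to the elements annihilated by an ideal. -/
def zeroColonCongr (e : A ≃ₗ[R] B) : GenCM.zeroColon A I ≃ₗ[R] GenCM.zeroColon B I :=
  LinearEquiv.ofLinearMap (zeroColonMap I e.toLinearMap) (zeroColonMap I e.symm.toLinearMap)
    (by ext x; simp [zeroColonMap]) (by ext x; simp [zeroColonMap])

variable {I}

lemma zeroColonMap_exact {f : A →ₗ[R] B} {g : B →ₗ[R] C} (hf : Function.Injective f)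
    (h : Function.Exact f g) : Function.Exact (zeroColonMap I f) (zeroColonMap I g) := by
  rintro ⟨b, hb⟩
  constructor
  · intro h0
    obtain ⟨a, rfl⟩ := (h b).1 (congrArg Subtype.val h0)
    refine ⟨⟨a, ?_⟩, rfl⟩
    rw [mem_zeroColon] at hb ⊢
    exact fun r hr => hf (by rw [map_smul, hb r hr, map_zero])
  · rintro ⟨a, ha⟩
    obtain rfl : f a = b := congrArg Subtype.val ha
    exact Subtype.ext (h.apply_apply_eq_zero a)

lemma zeroColonMap_injective {f : A →ₗ[R] B} (hf : Function.Injective f) :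
    Function.Injective (zeroColonMap I f) :=
  fun _ _ h => Subtype.ext (hf (congrArg Subtype.val h))

end ZeroColon

lemma exists_sum_mul_of_mem_mul {R : Type*} [CommRing R] {I K : Ideal R} {x : R}
    (hx : x ∈ I * K) : ∃ (r : ℕ) (y z : Fin r → R), (∀ j, y j ∈ I) ∧ (∀ j, z j ∈ K) ∧
      x = ∑ j, y j * z j := by
  induction hx using Submodule.mul_induction_on' with
  | mem_mul_mem a ha b hb =>
    exact ⟨1, fun _ => a, fun _ => b, fun _ => ha, fun _ => hb, by simp⟩
  | add a _ b _ iha ihb =>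
    obtain ⟨r, y, z, hy, hz, rfl⟩ := iha
    obtain ⟨s, y', z', hy', hz', rfl⟩ := ihb
    refine ⟨r + s, Fin.append y y', Fin.append z z', fun j => ?_, fun j => ?_, ?_⟩
    · refine Fin.addCases (fun i => ?_) (fun i => ?_) j <;> simp [hy, hy']
    · refine Fin.addCases (fun i => ?_) (fun i => ?_) j <;> simp [hz, hz']
    · simp [Fin.sum_univ_add]

variable {R : Type u} [CommRing R] {J : Ideal R} {M M' : Type u} [AddCommGroup M] [Module R M]
  [AddCommGroup M'] [Module R M']

section TorsionQuotient

variable (T : Submodule R M)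

/-- Multiplication by an element annihilating `T`, as a map `M / T → M`. -/
def smulLift (r : R) (hr : ∀ m ∈ T, r • m = 0) : (M ⧸ T) →ₗ[R] M :=
  T.liftQ (r • LinearMap.id) (fun m hm => LinearMap.mem_ker.2 (hr m hm))

variable {T}

@[simp] lemma smulLift_mk (r : R) (hr : ∀ m ∈ T, r • m = 0) (m : M) :
    smulLift T r hr (Submodule.Quotient.mk m) = r • m := rfl

lemma smulLift_comp_mkQ (r : R) (hr : ∀ m ∈ T, r • m = 0) :
    smulLift T r hr ∘ₗ T.mkQ = r • LinearMap.id := rfl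

variable [IsNoetherianRing R] (hT : IsPowTorsion J T)

include hT

lemma map_mkQ_surjective (i : ℕ) : Function.Surjective (map J i T.mkQ) := by
  intro c
  refine (exact_map_delta J T.injective_subtype T.mkQ_surjective
    (LinearMap.exact_subtype_mkQ T) i c).1 ?_
  exact lc_succ_eq_zero i T hT _

lemma map_mkQ_injective (i : ℕ) : Function.Injective (map J (i + 1) T.mkQ) := by
  rw [injective_iff_map_eq_zero]
  intro x hx
  obtain ⟨a, rfl⟩ := (map_exact J T.injective_subtype T.mkQ_surjective
    (LinearMap.exact_subtype_mkQ T) (i + 1) x).1 hx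
  rw [lc_succ_eq_zero i T hT a, map_zero]

/-- Every class on M / T comes from M because H^{i+1}(T) = 0, and there the map becomes
multiplication by `r`. -/
lemma map_smulLift_eq_zero {i : ℕ} {r : R} (hr : ∀ m ∈ T, r • m = 0)
    (hi : ∀ h : LC J i M, r • h = 0) (h : LC J i (M ⧸ T)) : map J i (smulLift T r hr) h = 0 := by
  obtain ⟨h, rfl⟩ := map_mkQ_surjective hT i h
  rw [← map_comp, smulLift_comp_mkQ, map_smul_id, hi]

omit [IsNoetherianRing R] in
-- T is its own H⁰, which embeds in H⁰(M).
lemma smul_eq_zero_of_lc_zero {r : R} (h0 : ∀ h : LC J 0 M, r • h = 0) (m : M) (hm : m ∈ T) :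
    r • m = 0 := by
  obtain ⟨e⟩ := nonempty_zeroEquiv hT
  have : r • (⟨m, hm⟩ : T) = 0 := by
    apply e.injective
    apply map_zero_injective J T.subtype T.injective_subtype
    rw [map_smul, map_smul, h0, map_zero, map_zero]
  exact congrArg Subtype.val this

end TorsionQuotient

section Splitting

variable [IsNoetherianRing R] {d n : ℕ} {x : R} {g : M →ₗ[R] M'}

omit [IsNoetherianRing R] in
lemma smulLift_injective {T : Submodule R M} (hT : ∀ m, m ∈ T ↔ x • m = 0) :
    Function.Injective (smulLift T x fun m hm => (hT m).1 hm) := by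
  rw [injective_iff_map_eq_zero]
  intro q hq
  obtain ⟨m, rfl⟩ := Submodule.Quotient.mk_surjective _ q
  exact (Submodule.Quotient.mk_eq_zero _).2 ((hT m).2 hq)

omit [IsNoetherianRing R] in
lemma smulLift_exact {T : Submodule R M} (hT : ∀ m, m ∈ T ↔ x • m = 0)
    (hg : ∀ m, g m = 0 ↔ ∃ m', x • m' = m) :
    Function.Exact (smulLift T x fun m hm => (hT m).1 hm) g := by
  intro m
  rw [hg]
  constructor
  · rintro ⟨m', rfl⟩
    exact ⟨Submodule.Quotient.mk m', rfl⟩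
  · rintro ⟨q, rfl⟩
    obtain ⟨m', rfl⟩ := Submodule.Quotient.mk_surjective _ q
    exact ⟨m', rfl⟩

/-- Classes annihilated by a small power of `J` lift along the connecting homomorphism attached to
multiplication by `x ∈ J ^ (2 * n)` to classes annihilated by the same power. -/
lemma exists_lift_annihilated {T : Submodule R M} (hT : ∀ m, m ∈ T ↔ x • m = 0)
    (hTJ : IsPowTorsion J T) (hx : x ∈ J ^ (2 * n)) (hgs : Function.Surjective g)
    (hg : ∀ m, g m = 0 ↔ ∃ m', x • m' = m)
    (hann : ∀ i < d, ∀ r ∈ J ^ n, ∀ h : LC J i M, r • h = 0) {i k : ℕ} (hi : i < d) (hk : k ≤ n)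
    (c : LC J (i + 1) (M ⧸ T)) (hc : ∀ r ∈ J ^ k, r • c = 0) :
    ∃ c' : LC J i M', (∀ r ∈ J ^ k, r • c' = 0) ∧
      delta J (smulLift_injective hT) hgs (smulLift_exact hT hg) i c' = c := by
  have hTn : ∀ r ∈ J ^ n, ∀ m ∈ T, r • m = 0 := fun r hr =>
    smul_eq_zero_of_lc_zero hTJ (hann 0 (by omega) r hr)
  rw [two_mul, pow_add] at hx
  obtain ⟨s, y, z, hy, hz, hxs⟩ := exists_sum_mul_of_mem_mul hx
  -- With x = ∑ yⱼ zⱼ, multiplication by `x` is `ym ∘ zm`; each yⱼ is defined on M / T because it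
  -- kills T.
  let zm : (M ⧸ T) →ₗ[R] (Fin s → M ⧸ T) := LinearMap.pi fun j => z j • LinearMap.id
  let ym : (Fin s → M ⧸ T) →ₗ[R] M :=
    ∑ j, smulLift T (y j) (hTn _ (hy j)) ∘ₗ LinearMap.proj j
  have hyz : ym ∘ₗ zm = smulLift T x fun m hm => (hT m).1 hm := by
    refine LinearMap.ext fun q => ?_
    obtain ⟨m, rfl⟩ := Submodule.Quotient.mk_surjective _ q
    simp only [ym, zm, LinearMap.comp_apply, LinearMap.sum_apply, LinearMap.proj_apply,
      LinearMap.pi_apply, LinearMap.smul_apply, LinearMap.id_apply, map_smul, smulLift_mk]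
    rw [hxs, Finset.sum_smul]
    exact Finset.sum_congr rfl fun j _ => by rw [smul_smul, mul_comm]
  have hzi : Function.Injective zm := by
    have : Function.Injective (ym ∘ₗ zm) := hyz ▸ smulLift_injective hT
    exact Function.Injective.of_comp this
  -- `γ` completes a morphism from the sequence of `zm` to the sequence of `x` that is the identity
  -- on M / T, so the two connecting maps agree through it.
  let γ : ((Fin s → M ⧸ T) ⧸ LinearMap.range zm) →ₗ[R] M' :=
    (LinearMap.range zm).liftQ (g ∘ₗ ym) (by
      rintro _ ⟨q, rfl⟩
      have := LinearMap.congr_fun hyz q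
      rw [LinearMap.mem_ker, LinearMap.comp_apply, ← LinearMap.comp_apply (f := ym), this]
      exact (smulLift_exact hT hg).apply_apply_eq_zero q)
  have hze : Function.Exact zm (LinearMap.range zm).mkQ := LinearMap.exact_map_mkQ_range zm
  have hzs : Function.Surjective (LinearMap.range zm).mkQ := Submodule.mkQ_surjective _
  have hzc : map J (i + 1) zm c = 0 := by
    have h1 : zm = ∑ j, LinearMap.single R (fun _ => M ⧸ T) j ∘ₗ (z j • LinearMap.id) := by
      refine LinearMap.ext fun q => funext fun j => ?_
      simp [zm, Finset.sum_apply, Pi.single_apply]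
    rw [h1, map_sum_hom]
    refine Finset.sum_eq_zero fun j _ => ?_
    rw [map_comp, map_smul_id, hc _ (Ideal.pow_le_pow_right hk (hz j)), map_zero]
  obtain ⟨c', rfl⟩ := (exact_delta_map J hzi hzs hze i c).1 hzc
  have hnat := delta_naturality J hzi hzs hze (smulLift_injective hT) hgs (smulLift_exact hT hg)
    LinearMap.id ym γ (by rw [hyz, LinearMap.comp_id]) rfl i
  refine ⟨map J i γ c', fun w hw => ?_, by rw [hnat, map_id]⟩
  -- The lift c' itself need not be killed by `w`: w c' only comes from Hⁱ((M / T)^s). After `γ` it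
  -- passes through `ym`, which is zero on Hⁱ.
  obtain ⟨e, he⟩ := (exact_map_delta J hzi hzs hze i (w • c')).1 (by rw [map_smul, hc w hw])
  have h2 : map J i ym e = 0 := by
    rw [map_sum_hom]
    refine Finset.sum_eq_zero fun j _ => ?_
    rw [map_comp]
    exact map_smulLift_eq_zero hTJ _ (hann i hi _ (hy j)) _
  rw [← map_smul, ← he, ← map_comp, show γ ∘ₗ (LinearMap.range zm).mkQ = g ∘ₗ ym from rfl,
    map_comp, h2, map_zero]

/-- Reduction modulo `x`: the `J ^ k`-socles of local cohomology form short exact sequences. -/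
theorem exists_zeroColon_exact {T : Submodule R M} (hT : ∀ m, m ∈ T ↔ x • m = 0)
    (hTJ : IsPowTorsion J T) (hx : x ∈ J ^ (2 * n)) (hgs : Function.Surjective g)
    (hg : ∀ m, g m = 0 ↔ ∃ m', x • m' = m)
    (hann : ∀ i < d, ∀ r ∈ J ^ n, ∀ h : LC J i M, r • h = 0) {i k : ℕ} (hi : i < d) (hk : k ≤ n) :
    ∃ (α : GenCM.zeroColon (LC J i M) (J ^ k) →ₗ[R] GenCM.zeroColon (LC J i M') (J ^ k))
      (β : GenCM.zeroColon (LC J i M') (J ^ k) →ₗ[R] GenCM.zeroColon (LC J (i + 1) M) (J ^ k)),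
      Function.Injective α ∧ Function.Exact α β ∧ Function.Surjective β := by
  have hinj : Function.Injective (map J i g) := by
    rw [injective_iff_map_eq_zero]
    intro a ha
    obtain ⟨b, rfl⟩ := (map_exact J (smulLift_injective hT) hgs (smulLift_exact hT hg) i a).1 ha
    refine map_smulLift_eq_zero hTJ _ (hann i hi x ?_) b
    exact Ideal.pow_le_pow_right (by omega) hx
  -- H^{i+1}(M) ≅ H^{i+1}(M / T), since T has no cohomology in positive degrees.
  let e := LinearEquiv.ofBijective (map J (i + 1) T.mkQ)
    ⟨map_mkQ_injective hTJ i, map_mkQ_surjective hTJ (i + 1)⟩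
  have hex := exact_map_delta J (smulLift_injective hT) hgs (smulLift_exact hT hg) i
  refine ⟨zeroColonMap _ (map J i g), zeroColonMap _ (e.symm.toLinearMap ∘ₗ
    delta J (smulLift_injective hT) hgs (smulLift_exact hT hg) i),
    zeroColonMap_injective hinj, zeroColonMap_exact hinj ?_, ?_⟩
  · intro b
    rw [← hex b]
    simp
  · rintro ⟨c, hc⟩
    rw [mem_zeroColon] at hc
    obtain ⟨c', hc', h⟩ := exists_lift_annihilated hT hTJ hx hgs hg hann hi hk (e c)
      (fun r hr => by rw [← map_smul, hc r hr, map_zero])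
    refine ⟨⟨c', (mem_zeroColon _).2 hc'⟩, Subtype.ext ?_⟩
    change e.symm (delta J _ _ _ i c') = c
    rw [h, LinearEquiv.symm_apply_apply]

/-- Reduction modulo `x` preserves the annihilation of local cohomology below the dimension. -/
theorem smul_lc_quotient_eq_zero {T : Submodule R M} (hT : ∀ m, m ∈ T ↔ x • m = 0)
    (hTJ : IsPowTorsion J T) (hx : x ∈ J ^ (2 * n)) (hgs : Function.Surjective g)
    (hg : ∀ m, g m = 0 ↔ ∃ m', x • m' = m)
    (hann : ∀ i < d, ∀ r ∈ J ^ n, ∀ h : LC J i M, r • h = 0) {i : ℕ} (hi : i + 1 < d) (r : R)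
    (hr : r ∈ J ^ n) (b : LC J i M') : r • b = 0 := by
  -- Taken with k = n: δ b is killed by J^n because i + 1 < d. Then b - c' comes from Hⁱ(M), also
  -- killed by J^n, so the exponent does not grow.
  obtain ⟨c', hc', h⟩ := exists_lift_annihilated hT hTJ hx hgs hg hann (i := i) (by omega) le_rfl
    (delta J (smulLift_injective hT) hgs (smulLift_exact hT hg) i b) (fun r hr => by
      obtain ⟨a, ha⟩ := map_mkQ_surjective hTJ (i + 1)
        (delta J (smulLift_injective hT) hgs (smulLift_exact hT hg) i b)
      rw [← ha, ← map_smul, hann _ hi r hr, map_zero])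
  obtain ⟨a, ha⟩ := (exact_map_delta J (smulLift_injective hT) hgs (smulLift_exact hT hg) i
    (b - c')).1 (by rw [map_sub, h, sub_self])
  rw [← sub_add_cancel b c', ← ha, smul_add, hc' r hr, ← map_smul, hann i (by omega) r hr,
    map_zero, add_zero]

end Splitting

end LocCoh

/-! ### Associated primes and filter regularity of parameters. -/

namespace LocCoh

section Support

variable {R : Type u} [CommRing R] [IsLocalRing R] [IsNoetherianRing R]

lemma isPowTorsion_of_support {N : Type*} [AddCommGroup N] [Module R N] [Module.Finite R N]
    (h : Module.support R N ⊆ {closedPoint R}) : IsPowTorsion (maximalIdeal R) N := by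
  have hrad : maximalIdeal R ≤ (Module.annihilator R N).radical := by
    rw [Ideal.radical_eq_sInf]
    refine le_sInf ?_
    rintro P ⟨hle, hP⟩
    have hmem : (⟨P, hP⟩ : PrimeSpectrum R) ∈ Module.support R N := by
      rw [Module.support_eq_zeroLocus]
      exact hle
    exact le_of_eq (congrArg PrimeSpectrum.asIdeal (h hmem)).symm
  obtain ⟨s, hs⟩ := Ideal.exists_pow_le_of_le_radical_of_fg hrad
    (IsNoetherian.noetherian (maximalIdeal R))
  exact isPowTorsion_of_pow (t := s) fun r hr x => Module.mem_annihilator.1 (hs hr) x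

omit [IsNoetherianRing R] in
lemma support_subset_of_isPowTorsion {N : Type*} [AddCommGroup N] [Module R N]
    [Module.Finite R N] (h : IsPowTorsion (maximalIdeal R) N) :
    Module.support R N ⊆ {closedPoint R} := by
  obtain ⟨s, hs⟩ := h.exists_pow
  intro P hP
  rw [Module.support_eq_zeroLocus] at hP
  have h1 : maximalIdeal R ^ s ≤ P.asIdeal := fun r hr =>
    hP (Module.mem_annihilator.2 fun x => hs r hr x)
  have h2 : maximalIdeal R ≤ P.asIdeal := P.2.le_of_pow_le h1
  exact PrimeSpectrum.ext ((maximalIdeal.isMaximal R).eq_of_le P.2.ne_top h2).symm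

omit [IsNoetherianRing R] in
lemma isPowTorsion_of_isFiniteLength {N : Type*} [AddCommGroup N] [Module R N]
    (h : IsFiniteLength R N) : IsPowTorsion (maximalIdeal R) N := by
  obtain ⟨h1, h2⟩ := isFiniteLength_iff_isNoetherian_isArtinian.1 h
  let f : ℕ →o (Submodule R N)ᵒᵈ :=
    { toFun := fun s => OrderDual.toDual (maximalIdeal R ^ s • (⊤ : Submodule R N))
      monotone' := fun s t hst => OrderDual.toDual_le_toDual.2
        (Submodule.smul_mono_left (Ideal.pow_le_pow_right hst)) }
  obtain ⟨s, hs⟩ := IsArtinian.monotone_stabilizes f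
  have h3 : maximalIdeal R ^ s • (⊤ : Submodule R N) =
      maximalIdeal R ^ (s + 1) • (⊤ : Submodule R N) :=
    OrderDual.toDual_inj.1 (hs (s + 1) (by omega))
  -- The descending chain of the 𝔪^s N has stabilised, so Nakayama applies.
  have h4 : maximalIdeal R ^ s • (⊤ : Submodule R N) = ⊥ := by
    refine Submodule.eq_bot_of_le_smul_of_le_jacobson_bot (maximalIdeal R) _
      (IsNoetherian.noetherian _) ?_ (IsLocalRing.maximalIdeal_le_jacobson _)
    rw [← mul_smul, ← pow_succ']
    exact h3.le
  refine isPowTorsion_of_pow (t := s) fun r hr x => ?_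
  have : r • x ∈ maximalIdeal R ^ s • (⊤ : Submodule R N) :=
    Submodule.smul_mem_smul hr Submodule.mem_top
  rwa [h4] at this

/-- Each element lowers the dimension by at most one, and after all `e` of them at most the closed
point is left. -/
lemma supportDim_le_of_zeroLocus {e : ℕ} (x : Fin e → R) (hx : ∀ j, x j ∈ maximalIdeal R)
    (N : Type u) [AddCommGroup N] [Module R N] [Module.Finite R N]
    (h : ∀ P ∈ Module.support R N, (∀ j, x j ∈ P.asIdeal) → P = closedPoint R) :
    Module.supportDim R N ≤ e := by
  induction e generalizing N with
  | zero =>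
    have : Subsingleton (Module.support R N) := ⟨fun P Q => Subtype.ext
      ((h P.1 P.2 fun j => j.elim0).trans (h Q.1 Q.2 fun j => j.elim0).symm)⟩
    exact Order.krullDim_nonpos_of_subsingleton
  | succ e ih =>
    refine (Module.supportDim_le_supportDim_quotSMulTop_succ (hx 0)).trans ?_
    rw [Nat.cast_succ]
    gcongr
    refine ih (fun j => x j.succ) (fun j => hx _) _ fun P hP hj => ?_
    rw [Module.support_quotSMulTop] at hP
    refine h P hP.1 fun j => ?_
    refine Fin.cases ?_ hj j
    exact hP.2 rfl

omit [IsLocalRing R] [IsNoetherianRing R] in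
lemma coheight_eq_supportDim (p : PrimeSpectrum R) :
    (Order.coheight p : WithBot ℕ∞) = Module.supportDim R (R ⧸ p.asIdeal) := by
  rw [Module.supportDim_quotient_eq_ringKrullDim, ringKrullDim_quotient,
    Order.coheight_eq_krullDim_Ici]
  rfl

/-- Otherwise 𝔪 lies in the union of the associated primes, so by prime avoidance in one of them,
and this yields a nonzero socle element. -/
lemma exists_isSMulRegular {N : Type*} [AddCommGroup N] [Module R N] [Module.Finite R N]
    (h : ∀ w : N, (∀ r ∈ maximalIdeal R, r • w = 0) → w = 0) :
    ∃ y ∈ maximalIdeal R, IsSMulRegular N y := by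
  by_contra! hcon
  have hsub : (maximalIdeal R : Set R) ⊆ ⋃ P ∈ associatedPrimes R N, (P : Set R) := by
    intro y hy
    rw [biUnion_associatedPrimes_eq_zero_divisors]
    have := hcon y hy
    rw [isSMulRegular_iff_right_eq_zero_of_smul] at this
    push Not at this
    obtain ⟨w, hw, hw0⟩ := this
    exact ⟨w, hw0, hw⟩
  obtain ⟨P, hP, hle⟩ := ((maximalIdeal R).subset_union_prime_finite
    (associatedPrimes.finite R N) (f := id) 0 0 fun _ h _ _ => h.isPrime).1 hsub
  obtain ⟨w, hw⟩ := (isAssociatedPrime_iff.1 hP).2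
  have hw0 : w = 0 := h w fun r hr => by
    have : r ∈ P := hle hr
    rw [hw] at this
    simpa [Submodule.mem_colon_singleton] using this
  apply hP.1.ne_top
  rw [hw, hw0]
  ext r
  simp [Submodule.mem_colon_singleton]

end Support

section Associated

variable {R : Type u} [CommRing R] [IsLocalRing R] [IsNoetherianRing R]

omit [IsLocalRing R] in
lemma exists_annihilator_of_mem_minimalPrimes {N : Type*} [AddCommGroup N] [Module R N]
    [Module.Finite R N] {P : Ideal R} (hP : P ∈ (Module.annihilator R N).minimalPrimes) :
    ∃ v : N, ∀ r, r ∈ P ↔ r • v = 0 := by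
  have := Module.associatedPrimes.minimalPrimes_annihilator_subset_associatedPrimes R N hP
  obtain ⟨v, hv⟩ := (isAssociatedPrime_iff.1 this).2
  refine ⟨v, fun r => ?_⟩
  rw [hv]
  simp [Submodule.mem_colon_singleton]

lemma isPowTorsion_of_minimalPrimes {N : Type*} [AddCommGroup N] [Module R N]
    [Module.Finite R N]
    (h : ∀ P ∈ (Module.annihilator R N).minimalPrimes, P = maximalIdeal R) :
    IsPowTorsion (maximalIdeal R) N := by
  apply isPowTorsion_of_support
  intro Q hQ
  rw [Module.support_eq_zeroLocus] at hQ
  obtain ⟨P, hP, hPQ⟩ := Ideal.exists_minimalPrimes_le (J := Q.asIdeal) hQ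
  rw [h P hP] at hPQ
  exact PrimeSpectrum.ext ((maximalIdeal.isMaximal R).eq_of_le Q.2.ne_top hPQ).symm

/-- A single power 𝔪^s kills the whole torsion submodule, so a lift of `w` is killed by 𝔪^(s+1). -/
lemma eq_zero_of_maximalIdeal_smul {M : Type u} [AddCommGroup M] [Module R M]
    [Module.Finite R M] (w : M ⧸ powTorsion (maximalIdeal R) M)
    (hw : ∀ r ∈ maximalIdeal R, r • w = 0) : w = 0 := by
  obtain ⟨m, rfl⟩ := Submodule.Quotient.mk_surjective _ w
  obtain ⟨s, hs⟩ := (isPowTorsion_powTorsion (J := maximalIdeal R) (N := M)).exists_pow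
  rw [Submodule.Quotient.mk_eq_zero]
  refine ⟨s + 1, fun r hr => ?_⟩
  rw [pow_succ] at hr
  induction hr using Submodule.mul_induction_on' with
  | mem_mul_mem a ha b hb =>
    have hb' : b • m ∈ powTorsion (maximalIdeal R) M :=
      (Submodule.Quotient.mk_eq_zero _).1 (hw b hb)
    rw [mul_smul]
    exact congrArg Subtype.val (hs a ha ⟨b • m, hb'⟩)
  | add a _ b _ iha ihb => rw [add_smul, iha, ihb, add_zero]

open scoped Pointwise in
/-- If the local cohomology of `M` below degree `d` is annihilated by a power of the maximal
ideal, then every associated prime other than the maximal ideal has dimension at least `d`. -/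
theorem le_coheight_of_smul_lc_eq_zero (d n : ℕ) (M : Type u) [AddCommGroup M] [Module R M]
    [Module.Finite R M]
    (hann : ∀ i < d, ∀ r ∈ maximalIdeal R ^ n, ∀ h : LC (maximalIdeal R) i M, r • h = 0)
    (p : PrimeSpectrum R) (hp : p ≠ closedPoint R) (v : M)
    (hv : ∀ r, r ∈ p.asIdeal ↔ r • v = 0) : (d : ℕ∞) ≤ Order.coheight p := by
  induction d generalizing M n p with
  | zero => simp
  | succ d ih =>
    have hpm : ∀ t : ℕ, ¬ maximalIdeal R ^ t ≤ p.asIdeal := fun t h => hp (PrimeSpectrum.ext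
      ((maximalIdeal.isMaximal R).eq_of_le p.2.ne_top (p.2.le_of_pow_le h)).symm)
    wlog hsoc : ∀ w : M, (∀ r ∈ maximalIdeal R, r • w = 0) → w = 0 generalizing M
    -- Dividing out the torsion removes the socle and keeps p as the annihilator of the image of
    -- `v`, because no power of 𝔪 lies in p.
    · refine this (M ⧸ powTorsion (maximalIdeal R) M) ?_ (Submodule.Quotient.mk v) ?_
        eq_zero_of_maximalIdeal_smul
      · intro i hi r hr h
        obtain ⟨h, rfl⟩ := map_mkQ_surjective isPowTorsion_powTorsion i h
        rw [← map_smul, hann i hi r hr, map_zero]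
      · intro r
        rw [← Submodule.Quotient.mk_smul, Submodule.Quotient.mk_eq_zero, hv]
        constructor
        · intro h
          rw [h]
          exact zero_mem _
        · rintro ⟨t, ht⟩
          rw [← hv]
          by_contra hr
          refine hpm t fun s hs => ?_
          have := ht s hs
          rw [← mul_smul, ← hv] at this
          exact (p.2.mem_or_mem this).resolve_right hr
    obtain ⟨y, hym, hy⟩ := exists_isSMulRegular hsoc
    let N : Submodule R M := Submodule.torsionBySet R M (p.asIdeal : Set R)
    have hN : ∀ w, w ∈ N ↔ ∀ r ∈ p.asIdeal, r • w = 0 := fun w => mem_zeroColon _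
    have hvN : v ∈ N := (hN v).2 fun r hr => (hv r).1 hr
    have hsupp : Module.support R N = PrimeSpectrum.zeroLocus (p.asIdeal : Set R) := by
      rw [Module.support_eq_zeroLocus]
      congr 2
      apply le_antisymm
      · intro r hr
        exact (hv r).2 (congrArg Subtype.val (Module.mem_annihilator.1 hr ⟨v, hvN⟩))
      · intro r hr
        exact Module.mem_annihilator.2 fun w => Subtype.ext ((hN w.1).1 w.2 r hr)
    let K : ℕ → Submodule R N := fun t => y ^ t • (⊤ : Submodule R N)
    let K' : ℕ → Submodule R M := fun t => y ^ t • (⊤ : Submodule R M)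
    -- Regularity of `y` gives N ∩ y^t M = y^t N, so N / y^t N embeds in M / y^t M.
    have hKK : ∀ t, K t = (K' t).comap N.subtype := by
      intro t
      apply le_antisymm
      · rintro _ ⟨w, -, rfl⟩
        exact ⟨w.1, trivial, rfl⟩
      · rintro w ⟨m, -, hm⟩
        have hm' : y ^ t • m = w.1 := hm
        have hmN : m ∈ N := (hN m).2 fun r hr => by
          apply hy.pow t
          change y ^ t • (r • m) = y ^ t • 0
          rw [smul_comm, hm', smul_zero, (hN w.1).1 w.2 r hr]
        exact ⟨⟨m, hmN⟩, trivial, Subtype.ext hm⟩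
    let ψ : ∀ t, (N ⧸ K t) →ₗ[R] (M ⧸ K' t) := fun t =>
      (K t).mapQ (K' t) N.subtype (hKK t).le
    have hψ : ∀ t, Function.Injective (ψ t) := fun t => by
      rw [← LinearMap.ker_eq_bot, Submodule.ker_mapQ, ← hKK t, Submodule.mkQ_map_self]
    have hsuppK : ∀ t, t ≠ 0 → Module.support R (N ⧸ K t) =
        PrimeSpectrum.zeroLocus (p.asIdeal : Set R) ∩ PrimeSpectrum.zeroLocus {y} := fun t ht => by
      refine (Module.support_quotSMulTop (M := N) (y ^ t)).trans ?_
      rw [hsupp, PrimeSpectrum.zeroLocus_singleton_pow _ _ (Nat.pos_of_ne_zero ht)]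
    have hg : ∀ t, Function.Exact (y ^ t • (LinearMap.id : M →ₗ[R] M)) (K' t).mkQ := by
      intro t m
      rw [Submodule.mkQ_apply, Submodule.Quotient.mk_eq_zero]
      constructor
      · rintro ⟨w, -, rfl⟩
        exact ⟨w, rfl⟩
      · rintro ⟨w, rfl⟩
        exact ⟨w, trivial, rfl⟩
    have hinj : ∀ t, Function.Injective (y ^ t • (LinearMap.id : M →ₗ[R] M)) := fun t => hy.pow t
    -- The long exact sequence of y^t costs one factor 𝔪^n from each neighbour; the resulting bound
    -- is independent of `t`.
    have hdel : ∀ t i, i < d → ∀ r ∈ maximalIdeal R ^ n, ∀ s ∈ maximalIdeal R ^ n,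
        ∀ h : LC (maximalIdeal R) i (M ⧸ K' t), (s * r) • h = 0 := by
      intro t i hi r hr s hs h
      obtain ⟨a, ha⟩ := (exact_map_delta _ (hinj t) (K' t).mkQ_surjective (hg t) i (r • h)).1
        (by rw [map_smul, hann _ (by omega) r hr])
      rw [mul_smul, ← ha, ← map_smul, hann _ (by omega) s hs, map_zero]
    -- A non-maximal P minimal over Ann(N / yN) strictly contains p and is associated to M / yM, so
    -- induction applies to it and gains one dimension. Otherwise N / yN is 𝔪-power torsion.
    by_cases hcase : ∃ P ∈ (Module.annihilator R (N ⧸ K 1)).minimalPrimes, P ≠ maximalIdeal R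
    · obtain ⟨P, hP, hPm⟩ := hcase
      obtain ⟨w, hw⟩ := exists_annihilator_of_mem_minimalPrimes hP
      have hPs : (⟨P, hP.1.1⟩ : PrimeSpectrum R) ∈ Module.support R (N ⧸ K 1) := by
        rw [Module.support_eq_zeroLocus]
        exact hP.1.2
      rw [hsuppK 1 one_ne_zero] at hPs
      have hlt : p < ⟨P, hP.1.1⟩ := by
        refine lt_of_le_of_ne hPs.1 fun h => ?_
        have hyp : y ∈ p.asIdeal := by
          rw [h]
          exact hPs.2 rfl
        have hv0 : v = 0 := hy (((hv y).1 hyp).trans (smul_zero y).symm)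
        exact p.2.ne_top ((Ideal.eq_top_iff_one _).2 ((hv 1).2 (by rw [hv0, smul_zero])))
      have := ih (n + n) (M ⧸ K' 1) (fun i hi r hr h => by
        rw [pow_add] at hr
        induction hr using Submodule.mul_induction_on' with
        | mem_mul_mem a ha b hb => exact hdel 1 i hi b hb a ha h
        | add a _ b _ iha ihb => rw [add_smul, iha, ihb, add_zero])
        ⟨P, hP.1.1⟩ (fun h => hPm (congrArg PrimeSpectrum.asIdeal h)) (ψ 1 w) (fun r => by
          rw [hw, ← map_smul, map_eq_zero_iff _ (hψ 1)])
      calc ((d + 1 : ℕ) : ℕ∞) = d + 1 := by push_cast; rfl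
        _ ≤ Order.coheight (⟨P, hP.1.1⟩ : PrimeSpectrum R) + 1 := by gcongr
        _ ≤ Order.coheight p := Order.coheight_add_one_le hlt
    · push Not at hcase
      obtain rfl | hd := Nat.eq_zero_or_pos d
      · have hlt : p < closedPoint R := lt_of_le_of_ne (le_maximalIdeal p.2.ne_top) hp
        refine le_trans ?_ (Order.coheight_add_one_le hlt)
        simp
      · exfalso
        have htor1 := support_subset_of_isPowTorsion (isPowTorsion_of_minimalPrimes hcase)
        obtain ⟨r, hr, hrp⟩ := SetLike.not_le_iff_exists.1 (hpm n)
        -- The torsion module N / y^t N embeds in H⁰(M / y^t M), so r² kills it for every t. By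
        -- Krull's intersection theorem r² v = 0, against r ∉ p.
        have hkill : ∀ t, t ≠ 0 → (r * r) • (⟨v, hvN⟩ : N) ∈ K t := by
          intro t ht
          have htor : IsPowTorsion (maximalIdeal R) (N ⧸ K t) := by
            apply isPowTorsion_of_support
            rwa [hsuppK t ht, ← hsuppK 1 one_ne_zero]
          obtain ⟨e⟩ := nonempty_zeroEquiv htor
          rw [← Submodule.Quotient.mk_eq_zero, Submodule.Quotient.mk_smul]
          apply e.injective
          apply map_zero_injective _ (ψ t) (hψ t)
          rw [map_smul, map_smul, hdel t 0 hd r hr r hr, map_zero, map_zero]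
        have hz : (r * r) • (⟨v, hvN⟩ : N) ∈ (⨅ t : ℕ, Ideal.span {y} ^ t • (⊤ : Submodule R N)) := by
          rw [Submodule.mem_iInf]
          intro t
          rcases Nat.eq_zero_or_pos t with rfl | ht
          · simp
          · rw [Ideal.span_singleton_pow, Submodule.ideal_span_singleton_smul]
            exact hkill t ht.ne'
        rw [Ideal.iInf_pow_smul_eq_bot_of_isLocalRing _
          (fun h => (maximalIdeal.isMaximal R).ne_top (top_le_iff.1 (h ▸
            (Ideal.span_singleton_le_iff_mem _).2 hym)))] at hz
        have : (r * r) • v = 0 := congrArg Subtype.val hz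
        rw [← hv] at this
        exact hrp (p.2.mem_or_mem this |>.elim id id)

/-- The first element of a system of parameters is filter regular if local cohomology below the
dimension is annihilated by a power of the maximal ideal. -/
theorem isPowTorsion_ker_smul {d n : ℕ} {M : Type u} [AddCommGroup M] [Module R M]
    [Module.Finite R M]
    (hann : ∀ i < d + 1, ∀ r ∈ maximalIdeal R ^ n, ∀ h : LC (maximalIdeal R) i M, r • h = 0)
    (x : Fin (d + 1) → R) (hx : ∀ j, x j ∈ maximalIdeal R)
    (hfin : IsPowTorsion (maximalIdeal R)
      (M ⧸ Ideal.span (Set.range x) • (⊤ : Submodule R M)))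
    (T : Submodule R M) (hT : ∀ m ∈ T, x 0 • m = 0) : IsPowTorsion (maximalIdeal R) T := by
  apply isPowTorsion_of_minimalPrimes
  intro P hP
  by_contra hPm
  obtain ⟨w, hw⟩ := exists_annihilator_of_mem_minimalPrimes hP
  have h1 := le_coheight_of_smul_lc_eq_zero (d + 1) n M hann ⟨P, hP.1.1⟩
    (fun h => hPm (congrArg PrimeSpectrum.asIdeal h)) w.1 (fun r => by
      rw [hw, ← Submodule.coe_smul, Submodule.coe_eq_zero])
  -- x₀ kills T and so lies in P: only the remaining `d` parameters are needed to cut V(P) down to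
  -- the closed point.
  have h2 : Module.supportDim R (R ⧸ P) ≤ d := by
    refine supportDim_le_of_zeroLocus (fun j : Fin d => x j.succ) (fun j => hx _) _ fun Q hQ hj => ?_
    rw [Module.support_eq_zeroLocus, Ideal.annihilator_quotient] at hQ
    have hxQ : ∀ j, x j ∈ Q.asIdeal := fun j =>
      Fin.cases (hQ ((hw _).2 (Subtype.ext (hT _ w.2)))) hj j
    apply support_subset_of_isPowTorsion hfin
    rw [Module.support_quotient]
    refine ⟨?_, ?_⟩
    · rw [Module.support_eq_zeroLocus]
      intro r hr
      exact hQ ((hw r).2 (Subtype.ext (Module.mem_annihilator.1 hr w.1)))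
    · rw [PrimeSpectrum.zeroLocus_span]
      rintro _ ⟨j, rfl⟩
      exact hxQ j
  rw [← coheight_eq_supportDim ⟨P, hP.1.1⟩] at h2
  have h3 : ((d + 1 : ℕ) : ℕ∞) ≤ d := h1.trans (by exact_mod_cast h2)
  have h4 : d + 1 ≤ d := by exact_mod_cast h3
  omega

end Associated

end LocCoh

/-! ### Colon quotients and the induction on the number of parameters. -/

namespace LocCoh

section ColonQuotient

variable {R : Type*} [CommRing R] {M : Type*} [AddCommGroup M] [Module R M]

/-- The quotient `(N :_M J) / N` is the submodule of `M / N` annihilated by `J`. -/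
lemma nonempty_colonQuotientEquiv (N : Submodule R M) (J : Ideal R) :
    Nonempty (GenCM.ColonQuotient N J ≃ₗ[R] GenCM.zeroColon (M ⧸ N) J) := by
  let φ : GenCM.colonIn N J →ₗ[R] GenCM.zeroColon (M ⧸ N) J :=
    (N.mkQ ∘ₗ (GenCM.colonIn N J).subtype).codRestrict _ fun m => (mem_zeroColon J).2 fun r hr =>
      (Submodule.Quotient.mk_eq_zero N).2 (m.2 r hr)
  have hker : LinearMap.ker φ = N.submoduleOf (GenCM.colonIn N J) := by
    ext m
    rw [LinearMap.mem_ker, Submodule.submoduleOf, Submodule.mem_comap,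
      ← Submodule.Quotient.mk_eq_zero N]
    exact ⟨congrArg Subtype.val, fun h => Subtype.ext h⟩
  have hsur : Function.Surjective φ := by
    rintro ⟨q, hq⟩
    obtain ⟨m, rfl⟩ := Submodule.Quotient.mk_surjective _ q
    rw [mem_zeroColon] at hq
    exact ⟨⟨m, fun r hr => (Submodule.Quotient.mk_eq_zero N).1 (hq r hr)⟩, rfl⟩
  exact ⟨(Submodule.quotEquivOfEq _ _ hker.symm).trans (φ.quotKerEquivOfSurjective hsur)⟩

end ColonQuotient

section QuotientSequence

variable {R : Type*} [CommRing R] {M : Type*} [AddCommGroup M] [Module R M]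

lemma span_range_fin_succ {d : ℕ} (x : Fin (d + 1) → R) :
    Ideal.span (Set.range x) = Ideal.span {x 0} ⊔ Ideal.span (Set.range fun j : Fin d => x j.succ) := by
  rw [← Ideal.span_union]
  congr 1
  ext r
  simp [Fin.exists_fin_succ, eq_comm]

/-- Quotients by a sequence can be computed in two steps. -/
def quotientSuccEquiv {d : ℕ} (x : Fin (d + 1) → R) :
    ((M ⧸ Ideal.span {x 0} • (⊤ : Submodule R M)) ⧸
      Ideal.span (Set.range fun j : Fin d => x j.succ) •
        (⊤ : Submodule R (M ⧸ Ideal.span {x 0} • (⊤ : Submodule R M)))) ≃ₗ[R]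
      (M ⧸ Ideal.span (Set.range x) • (⊤ : Submodule R M)) :=
  (Submodule.quotEquivOfEq _ _ (by
    rw [Submodule.map_smul'', Submodule.map_top, Submodule.range_mkQ])).trans
  ((Submodule.quotientQuotientEquivQuotientSup (Ideal.span {x 0} • (⊤ : Submodule R M))
    (Ideal.span (Set.range fun j : Fin d => x j.succ) • ⊤)).trans
  (Submodule.quotEquivOfEq _ _ (by rw [span_range_fin_succ, Submodule.sup_smul])))

end QuotientSequence

/-- Pascal's rule, grouped so that h i + h (i + 1) matches one short exact sequence; it uses no
subtraction, as needed for lengths in `ℕ∞` and for cardinals. -/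
lemma sum_choose_succ {S : Type*} [CommSemiring S] (d : ℕ) (h : ℕ → S) :
    ∑ i ∈ Finset.range (d + 1 + 1), ((d + 1).choose i : S) * h i =
      ∑ i ∈ Finset.range (d + 1), (d.choose i : S) * (h i + h (i + 1)) := by
  rw [Finset.sum_range_succ']
  simp only [Nat.choose_succ_succ', Nat.cast_add, add_mul, mul_add, Finset.sum_add_distrib,
    Nat.choose_zero_right]
  rw [Finset.sum_range_succ (fun i => ((d.choose (i + 1) : ℕ) : S) * h (i + 1)),
    Finset.sum_range_succ' (fun i => ((d.choose i : ℕ) : S) * h i)]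
  simp only [Nat.choose_succ_self, Nat.cast_zero, zero_mul, add_zero, Nat.choose_zero_right]
  ring

section Main

variable {R : Type u} [CommRing R] [IsLocalRing R] [IsNoetherianRing R]

/-- An invariant which is additive along short exact sequences of submodules annihilated by
`𝔪 ^ k` takes the expected value at the reduction modulo a system of parameters. -/
theorem invariant_quotient_eq_sum {S : Type*} [CommSemiring S]
    (μ : ∀ (N : Type u) [AddCommGroup N] [Module R N], S) {n k : ℕ} (hk : k ≤ n)
    (hadd : ∀ (A B C : Type u) [AddCommGroup A] [Module R A] [AddCommGroup B] [Module R B]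
      [AddCommGroup C] [Module R C]
      (α : GenCM.zeroColon A (maximalIdeal R ^ k) →ₗ[R] GenCM.zeroColon B (maximalIdeal R ^ k))
      (β : GenCM.zeroColon B (maximalIdeal R ^ k) →ₗ[R] GenCM.zeroColon C (maximalIdeal R ^ k)),
      Function.Injective α → Function.Exact α β → Function.Surjective β → μ B = μ A + μ C)
    (hcongr : ∀ (A B : Type u) [AddCommGroup A] [Module R A] [AddCommGroup B] [Module R B],
      (A ≃ₗ[R] B) → μ A = μ B)
    (d : ℕ) (M : Type u) [AddCommGroup M] [Module R M] [Module.Finite R M]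
    (hann : ∀ i < d, ∀ r ∈ maximalIdeal R ^ n, ∀ h : LC (maximalIdeal R) i M, r • h = 0)
    (x : Fin d → R) (hx : ∀ j, x j ∈ maximalIdeal R)
    (hxn : ∀ j, x j ∈ maximalIdeal R ^ (2 * n))
    (hfin : IsPowTorsion (maximalIdeal R)
      (M ⧸ Ideal.span (Set.range x) • (⊤ : Submodule R M))) :
    μ (M ⧸ Ideal.span (Set.range x) • (⊤ : Submodule R M)) =
      ∑ i ∈ Finset.range (d + 1), (d.choose i : S) * μ (LC (maximalIdeal R) i M) := by
  induction d generalizing M with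
  | zero =>
    have hbot : Ideal.span (Set.range x) • (⊤ : Submodule R M) = ⊥ := by
      rw [Set.range_eq_empty, Ideal.span_empty, Submodule.bot_smul]
    let e := Submodule.quotEquivOfEqBot _ hbot
    -- With no parameters left, the module is torsion and agrees with its H⁰.
    obtain ⟨e'⟩ := nonempty_zeroEquiv (hfin.of_surjective e.toLinearMap e.surjective)
    simpa using hcongr _ _ (e.trans e')
  | succ d ih =>
    let T := LinearMap.ker (LinearMap.lsmul R M (x 0))
    have hT : ∀ m, m ∈ T ↔ x 0 • m = 0 := fun m => Iff.rfl
    have hTJ : IsPowTorsion (maximalIdeal R) T :=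
      isPowTorsion_ker_smul hann x hx hfin T fun m hm => (hT m).1 hm
    have hgs := Submodule.mkQ_surjective (Ideal.span {x 0} • (⊤ : Submodule R M))
    have hg : ∀ m, (Ideal.span {x 0} • (⊤ : Submodule R M)).mkQ m = 0 ↔ ∃ m', x 0 • m' = m := by
      intro m
      rw [Submodule.mkQ_apply, Submodule.Quotient.mk_eq_zero,
        Submodule.ideal_span_singleton_smul, Submodule.mem_smul_pointwise_iff_exists]
      simp
    -- Only the annihilation, with `d` lowered by one and `n` unchanged, is carried along; the Krull
    -- dimension of the quotient is never needed.
    have hstep := ih (M ⧸ Ideal.span {x 0} • (⊤ : Submodule R M))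
      (fun i hi r hr h => smul_lc_quotient_eq_zero hT hTJ (hxn 0) hgs hg hann
        (Nat.succ_lt_succ hi) r hr h)
      (fun j => x j.succ) (fun j => hx _) (fun j => hxn _)
      (hfin.of_injective (quotientSuccEquiv x).toLinearMap (quotientSuccEquiv x).injective)
    rw [← hcongr _ _ (quotientSuccEquiv x), hstep, sum_choose_succ]
    refine Finset.sum_congr rfl fun i hi => ?_
    obtain ⟨α, β, h1, h2, h3⟩ := exists_zeroColon_exact hT hTJ (hxn 0) hgs hg hann
      (Finset.mem_range.1 hi) hk
    rw [hadd _ _ _ α β h1 h2 h3]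

omit [IsNoetherianRing R] in
lemma socDim_congr {A B : Type u} [AddCommGroup A] [Module R A] [AddCommGroup B] [Module R B]
    (e : A ≃ₗ[R] B) : GenCM.socDim R A = GenCM.socDim R B := by
  have hs : Function.Surjective (algebraMap R (R ⧸ maximalIdeal R)) := Ideal.Quotient.mk_surjective
  exact ((zeroColonCongr (maximalIdeal R) e).extendScalarsOfSurjective hs).rank_eq

omit [IsNoetherianRing R] in
-- Rank–nullity over the residue field; `R`-linear maps between socles are linear over it because R
-- → R / 𝔪 is surjective.
lemma socDim_eq_add {A B C : Type u} [AddCommGroup A] [Module R A] [AddCommGroup B] [Module R B]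
    [AddCommGroup C] [Module R C] (α : GenCM.Soc R A →ₗ[R] GenCM.Soc R B)
    (β : GenCM.Soc R B →ₗ[R] GenCM.Soc R C) (hα : Function.Injective α)
    (hαβ : Function.Exact α β) (hβ : Function.Surjective β) :
    GenCM.socDim R B = GenCM.socDim R A + GenCM.socDim R C := by
  have hs : Function.Surjective (algebraMap R (R ⧸ maximalIdeal R)) := Ideal.Quotient.mk_surjective
  let _ := Ideal.Quotient.field (maximalIdeal R)
  let α' := α.extendScalarsOfSurjective hs
  let β' := β.extendScalarsOfSurjective hs
  have h1 := LinearMap.rank_range_add_rank_ker β'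
  have h2 : LinearMap.range β' = ⊤ := LinearMap.range_eq_top.2 hβ
  have h3 : LinearMap.ker β' = LinearMap.range α' :=
    LinearMap.exact_iff.1 (show Function.Exact α' β' from hαβ)
  have h4 := _root_.rank_range_of_injective α' hα
  rw [h2, rank_top, h3, h4, add_comm] at h1
  exact h1.symm

end Main

end LocCoh

end

/-! ### The length and socle formulas. -/

open LocCoh

theorem corollary4p3 {R : Type u} [CommRing R] [IsLocalRing R] [IsNoetherianRing R]
    (M : Type u) [AddCommGroup M] [Module R M] (d : ℕ)
    (hM : GenCM.IsGeneralizedCohenMacaulay R M d)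
    (n₀ : ℕ) (hn₀ : 0 < n₀)
    (hann : ∀ i < d, maximalIdeal R ^ n₀ • (⊤ : Submodule R (GenCM.H R M i)) = ⊥) :
    (∀ k ≤ n₀,
      (∀ q q' : Ideal R,
        GenCM.IsParameterIdeal R M q → q ≤ maximalIdeal R ^ (2 * n₀) →
        GenCM.IsParameterIdeal R M q' → q' ≤ maximalIdeal R ^ (2 * n₀) →
        Module.length R
            (GenCM.ColonQuotient (q • (⊤ : Submodule R M)) (maximalIdeal R ^ k)) =
          Module.length R
            (GenCM.ColonQuotient (q' • (⊤ : Submodule R M)) (maximalIdeal R ^ k))) ∧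
      (∀ q : Ideal R,
        GenCM.IsParameterIdeal R M q → q ≤ maximalIdeal R ^ (2 * n₀) →
        Module.length R
            (GenCM.ColonQuotient (q • (⊤ : Submodule R M)) (maximalIdeal R ^ k)) =
          ∑ i ∈ Finset.range (d + 1), (d.choose i : ℕ∞) *
            Module.length R (GenCM.zeroColon (GenCM.H R M i) (maximalIdeal R ^ k)))) ∧
    (∀ q q' : Ideal R,
      GenCM.IsParameterIdeal R M q → q ≤ maximalIdeal R ^ (2 * n₀) →
      GenCM.IsParameterIdeal R M q' → q' ≤ maximalIdeal R ^ (2 * n₀) →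
      GenCM.indexOfIrreducibility R M q = GenCM.indexOfIrreducibility R M q') ∧
    (∀ q : Ideal R,
      GenCM.IsParameterIdeal R M q → q ≤ maximalIdeal R ^ (2 * n₀) →
      GenCM.indexOfIrreducibility R M q =
        ∑ i ∈ Finset.range (d + 1), (d.choose i : Cardinal.{u}) *
          GenCM.socDim R (GenCM.H R M i)) := by
  have := hM.finite
  have hann' : ∀ i < d, ∀ r ∈ maximalIdeal R ^ n₀, ∀ h : LC (maximalIdeal R) i M, r • h = 0 := by
    intro i hi r hr h
    have h1 : r • h ∈ maximalIdeal R ^ n₀ • (⊤ : Submodule R (GenCM.H R M i)) :=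
      Submodule.smul_mem_smul hr Submodule.mem_top
    rwa [hann i hi] at h1
  have hpar : ∀ q : Ideal R, GenCM.IsParameterIdeal R M q → q ≤ maximalIdeal R ^ (2 * n₀) →
      ∃ x : Fin d → R, q = Ideal.span (Set.range x) ∧ (∀ j, x j ∈ maximalIdeal R) ∧
        (∀ j, x j ∈ maximalIdeal R ^ (2 * n₀)) ∧
        IsPowTorsion (maximalIdeal R) (M ⧸ Ideal.span (Set.range x) • (⊤ : Submodule R M)) := by
    rintro q ⟨d', hd', x, hx, rfl, hfin⟩ hle
    have hdd : (d' : WithBot ℕ∞) = d := hd'.symm.trans hM.dim_eq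
    obtain rfl : d' = d := by exact_mod_cast hdd
    exact ⟨x, rfl, hx, fun j => hle (Ideal.subset_span ⟨j, rfl⟩),
      isPowTorsion_of_isFiniteLength hfin⟩
  have hlen : ∀ k ≤ n₀, ∀ q : Ideal R,
      GenCM.IsParameterIdeal R M q → q ≤ maximalIdeal R ^ (2 * n₀) →
      Module.length R
          (GenCM.ColonQuotient (q • (⊤ : Submodule R M)) (maximalIdeal R ^ k)) =
        ∑ i ∈ Finset.range (d + 1), (d.choose i : ℕ∞) *
          Module.length R (GenCM.zeroColon (GenCM.H R M i) (maximalIdeal R ^ k)) := by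
    intro k hk q hq hle
    obtain ⟨x, rfl, hx, hxn, hfin⟩ := hpar q hq hle
    obtain ⟨e⟩ := nonempty_colonQuotientEquiv
      (Ideal.span (Set.range x) • (⊤ : Submodule R M)) (maximalIdeal R ^ k)
    rw [e.length_eq]
    exact invariant_quotient_eq_sum
      (fun N _ _ => Module.length R (GenCM.zeroColon N (maximalIdeal R ^ k))) hk
      (fun A B C _ _ _ _ _ _ α β h1 h2 h3 => Module.length_eq_add_of_exact α β h1 h3 h2)
      (fun A B _ _ _ _ e => (zeroColonCongr _ e).length_eq) d M hann' x hx hxn hfin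
  have hsoc : ∀ q : Ideal R,
      GenCM.IsParameterIdeal R M q → q ≤ maximalIdeal R ^ (2 * n₀) →
      GenCM.indexOfIrreducibility R M q =
        ∑ i ∈ Finset.range (d + 1), (d.choose i : Cardinal.{u}) *
          GenCM.socDim R (GenCM.H R M i) := by
    intro q hq hle
    obtain ⟨x, rfl, hx, hxn, hfin⟩ := hpar q hq hle
    refine invariant_quotient_eq_sum (fun N _ _ => GenCM.socDim R N) hn₀ ?_
      (fun A B _ _ _ _ e => socDim_congr e) d M hann' x hx hxn hfin
    -- The socle is the case k = 1; `hn₀`, read as `Nat.succ 0 ≤ n₀`, supplied this `k`.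
    rw [show Nat.succ 0 = 1 from rfl, pow_one]
    intro A B C _ _ _ _ _ _ α β h1 h2 h3
    exact socDim_eq_add α β h1 h2 h3
  exact ⟨fun k hk => ⟨fun q q' hq hle hq' hle' => (hlen k hk q hq hle).trans
    (hlen k hk q' hq' hle').symm, hlen k hk⟩, fun q q' hq hle hq' hle' => (hsoc q hq hle).trans
    (hsoc q' hq' hle').symm, hsoc⟩
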